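/- **Setting.** For $\varepsilon\in\mathbb R$ let $\mathcal W=\mathcal W(\varepsilon)$ be the unital complex algebra generated by $a_+,a_-,b_+,b_-$ with relations $[a_-,a_+]=[b_-,b_+]=\varepsilon$, every $a_\pm$ commuting with every $b_\pm$. Let $\dagger$ be the conjugate-linear anti-automorphism with $a_\pm^\dagger=a_\mp$, $b_\pm^\dagger=b_\mp$, write $\mathrm{Ad}_T(w)=[T,w]$, and put $J_-=a_-b_+$, $K_0=\tfrac12(a_+a_-+b_+b_-+\varepsilon)$. Every element of $\mathcal W$ is uniquely a totally symmetric polynomial in the generators (a combination of words whose coefficients are invariant under permuting letters). Sorting the words by their last two letters, $w=w_1a_+a_-+w_2a_-a_++w_3b_+b_-+w_4b_-b_++w_5a_+^2+\cdots$, its formal trace is $\mathrm{tr}(w)=w_1+w_2+w_3+w_4$. Let $\Psi=\ker(\mathrm{tr})$ and, for $\varepsilon\neq0$, $\Psi_r=\{\xi\in\Psi: \mathrm{Ad}_{K_0}\xi=\varepsilon r\,\xi\}$; as spaces of totally symmetric polynomials these do not depend on $\varepsilon$. For $R\ge0$ let $\hat R=(R^2+\tfrac14\varepsilon^2)^{1/2}$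 and let $\rho=\rho_R:\mathcal W\to\Psi$ be the projection onto $\Psi$ with kernel $\{w(K_0-\hat R):w\in\mathcal W\}$; the product of $\xi,\zeta\in\Psi$ is $\rho(\xi\zeta)$. For $\varepsilon\ne0$, $n\geq 0$, $|r|\le n$, $|m|\le n$ with $2n,n+r,n+m\in\mathbb Z$ put $$P(n,r,m)=\varepsilon^{m-n}\left(\frac{(n+m)!}{(2n)!\,(n-m)!}\right)^{1/2}(\mathrm{Ad}_{J_-})^{n-m}\bigl(a_+^{n+r}b_-^{n-r}\bigr),$$ $$\omega^{r_1r_2}_n(\xi)=\sum_{m=-n}^{n}\rho\bigl(P(n,r_2,m)^\dagger\,\xi\,P(n,r_1,m)\bigr).$$ When $2\hat R+\varepsilon>0$ (that is, unless $R=0$ and $\varepsilon\leq 0$) put, for $m\in\{-1,0,1\}$, $x^m=(2\hat R+\varepsilon)^{-1/2}P(1,0,m)$, and define the exterior derivative $$df=\varepsilon^{-1}(2\hat R+\varepsilon)^{-1}\,\omega^{01}_1(f).$$ **Lemma.** (1) Let $\varepsilon\neq0$, $R\ge0$ and $2\hat R+\varepsilon>0$. Then $d$ maps $\Psi_0$ into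 $\Psi_{-1}$. The two definitions of the basis 1-forms agree: applying $d$ to the coordinate $x^m$ gives $$d(x^m)=dx^m:=(2\hat R+\varepsilon)^{-1/2}P(1,-1,m)\qquad(m\in\{-1,0,1\}).$$ For all integers $n\ge0$ and $|m|\le n$, $$dP(n,0,m)=2n\,\bigl(\hat R+\tfrac12\varepsilon n\bigr)\,(2\hat R+\varepsilon)^{-1}\,P(n,-1,m)$$ (for $n=0$ the right-hand side is read as $0$). (2) Let $R>0$ be fixed, and let $f,g\in\Psi_0$ be fixed as totally symmetric polynomials (independent of $\varepsilon$). Then, as $\varepsilon\to0$, $\varepsilon\ne0$, $$d(\rho(fg))=\rho\bigl(d(f)\,g\bigr)+\rho\bigl(f\,d(g)\bigr)+O(\varepsilon),$$ where $O(\varepsilon)$ is a formally traceless totally symmetric polynomial, supported on a fixed finite set of words, whose coefficients are bounded by $C|\varepsilon|$ for $|\varepsilon|$ small; the finite set and $C$ depend only on $R,f,g$. -/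

import Mathlib

noncomputable section

namespace FuzzySphere

/-- The four generators `a₊, a₋, b₊, b₋`. -/
inductive Gen : Type
  | ap
  | am
  | bp
  | bm

/-- The letters of the free algebra on the four generators. -/
abbrev letter (g : Gen) : FreeAlgebra ℂ Gen := FreeAlgebra.ι ℂ g

/-- The relations `[a₋, a₊] = ε`, `[b₋, b₊] = ε`; every `a` commutes with every `b`. -/
inductive Rel (ε : ℝ) : FreeAlgebra ℂ Gen → FreeAlgebra ℂ Gen → Prop
  | aa : Rel ε (letter .am * letter .ap - letter .ap * letter .am)
      (algebraMap ℂ (FreeAlgebra ℂ Gen) (ε : ℂ))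
  | bb : Rel ε (letter .bm * letter .bp - letter .bp * letter .bm)
      (algebraMap ℂ (FreeAlgebra ℂ Gen) (ε : ℂ))
  | apbp : Rel ε (letter .ap * letter .bp) (letter .bp * letter .ap)
  | apbm : Rel ε (letter .ap * letter .bm) (letter .bm * letter .ap)
  | ambp : Rel ε (letter .am * letter .bp) (letter .bp * letter .am)
  | ambm : Rel ε (letter .am * letter .bm) (letter .bm * letter .am)

/-- The product `𝒲(ε)` of two Heisenberg-Weyl algebras, as a quotient of the free algebra. -/
abbrev W (ε : ℝ) : Type := RingQuot (Rel ε)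

/-- The class of a generator in `𝒲(ε)`. -/
def gen (ε : ℝ) (g : Gen) : W ε := RingQuot.mkAlgHom ℂ (Rel ε) (letter g)

/-- `J₀ = (a₊ a₋ - b₊ b₋) / 2`. -/
def J0 (ε : ℝ) : W ε := (1 / 2 : ℂ) • (gen ε .ap * gen ε .am - gen ε .bp * gen ε .bm)

/-- `J₊ = a₊ b₋`. -/
def Jp (ε : ℝ) : W ε := gen ε .ap * gen ε .bm

/-- `J₋ = a₋ b₊`. -/
def Jm (ε : ℝ) : W ε := gen ε .am * gen ε .bp

/-- `K₀ = (a₊ a₋ + b₊ b₋ + ε) / 2`. -/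
def K0 (ε : ℝ) : W ε :=
  (1 / 2 : ℂ) • (gen ε .ap * gen ε .am + gen ε .bp * gen ε .bm + algebraMap ℂ (W ε) (ε : ℂ))

/-! ### The conjugation -/

/-- Exchange of `+` and `-`. -/
def Gen.flip : Gen → Gen
  | .ap => .am
  | .am => .ap
  | .bp => .bm
  | .bm => .bp

/-- The opposite ring of `𝒲(ε)`, seen as a complex algebra through complex conjugation: algebra
homomorphisms into it are conjugate-linear anti-homomorphisms into `𝒲(ε)`. -/
def ConjOp (ε : ℝ) : Type := (W ε)ᵐᵒᵖ

instance (ε : ℝ) : Ring (ConjOp ε) := inferInstanceAs (Ring (W ε)ᵐᵒᵖ)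

instance (ε : ℝ) : Algebra ℂ (ConjOp ε) :=
  RingHom.toAlgebra' ((algebraMap ℂ (W ε)ᵐᵒᵖ).comp (starRingEnd ℂ))
    (fun c x => Algebra.commutes (A := (W ε)ᵐᵒᵖ) (starRingEnd ℂ c) x)

/-- The conjugation on the free algebra, with values in `𝒲(ε)`. -/
def daggerFree (ε : ℝ) : FreeAlgebra ℂ Gen →ₐ[ℂ] ConjOp ε :=
  FreeAlgebra.lift ℂ (fun g => (MulOpposite.op (gen ε g.flip) : (W ε)ᵐᵒᵖ))

theorem daggerFree_rel (ε : ℝ) ⦃x y : FreeAlgebra ℂ Gen⦄ (h : Rel ε x y) :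
    daggerFree ε x = daggerFree ε y := by
  have hι : ∀ g, daggerFree ε (letter g) =
      (MulOpposite.op (gen ε g.flip) : (W ε)ᵐᵒᵖ) := fun g => by
    simp only [daggerFree, letter]
    exact FreeAlgebra.lift_ι_apply _ _
  have hmul : ∀ g g', daggerFree ε (letter g * letter g') =
      (MulOpposite.op (gen ε g'.flip * gen ε g.flip) : (W ε)ᵐᵒᵖ) := fun g g' => by
    rw [map_mul, hι, hι]
    rfl
  have hsub : ∀ x y : W ε, (MulOpposite.op x : (W ε)ᵐᵒᵖ) - MulOpposite.op y
      = MulOpposite.op (x - y) := fun x y => rfl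
  have hsc : daggerFree ε (algebraMap ℂ (FreeAlgebra ℂ Gen) (ε : ℂ)) =
      (MulOpposite.op (algebraMap ℂ (W ε) (ε : ℂ)) : (W ε)ᵐᵒᵖ) := by
    rw [AlgHom.commutes]
    change algebraMap ℂ (W ε)ᵐᵒᵖ (starRingEnd ℂ (ε : ℂ)) = _
    rw [Complex.conj_ofReal]
    rfl
  have key : ∀ {x y}, Rel ε x y →
      RingQuot.mkAlgHom ℂ (Rel ε) x = RingQuot.mkAlgHom ℂ (Rel ε) y :=
    fun h => RingQuot.mkAlgHom_rel ℂ h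
  cases h with
  | aa =>
    have := key (Rel.aa (ε := ε))
    rw [map_sub, map_mul, map_mul, AlgHom.commutes] at this
    rw [map_sub, hmul, hmul, hsc]
    exact congrArg MulOpposite.op this
  | bb =>
    have := key (Rel.bb (ε := ε))
    rw [map_sub, map_mul, map_mul, AlgHom.commutes] at this
    rw [map_sub, hmul, hmul, hsc]
    exact congrArg MulOpposite.op this
  | apbp =>
    have := key (Rel.ambm (ε := ε))
    rw [map_mul, map_mul] at this
    rw [hmul, hmul]
    exact congrArg MulOpposite.op this.symm
  | apbm =>
    have := key (Rel.ambp (ε := ε))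
    rw [map_mul, map_mul] at this
    rw [hmul, hmul]
    exact congrArg MulOpposite.op this.symm
  | ambp =>
    have := key (Rel.apbm (ε := ε))
    rw [map_mul, map_mul] at this
    rw [hmul, hmul]
    exact congrArg MulOpposite.op this.symm
  | ambm =>
    have := key (Rel.apbp (ε := ε))
    rw [map_mul, map_mul] at this
    rw [hmul, hmul]
    exact congrArg MulOpposite.op this.symm

/-- The conjugation `†` on `𝒲(ε)`: the conjugate-linear anti-homomorphism that exchanges
`a₊` with `a₋` and `b₊` with `b₋`. -/
def dagger (ε : ℝ) (w : W ε) : W ε :=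
  MulOpposite.unop
    (RingQuot.liftAlgHom ℂ ⟨daggerFree ε, daggerFree_rel ε⟩ w : (W ε)ᵐᵒᵖ)

theorem dagger_gen (ε : ℝ) (g : Gen) : dagger ε (gen ε g) = gen ε g.flip := by
  have h : RingQuot.liftAlgHom ℂ ⟨daggerFree ε, daggerFree_rel ε⟩ (gen ε g) =
      daggerFree ε (letter g) := RingQuot.liftAlgHom_mkAlgHom_apply _ _ _ _
  rw [dagger, h]
  have hι : daggerFree ε (letter g) = (MulOpposite.op (gen ε g.flip) : (W ε)ᵐᵒᵖ) :=
    FreeAlgebra.lift_ι_apply _ _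
  rw [hι]
  rfl

theorem dagger_add (ε : ℝ) (w w' : W ε) : dagger ε (w + w') = dagger ε w + dagger ε w' := by
  unfold dagger
  rw [map_add]
  rfl

theorem dagger_mul (ε : ℝ) (w w' : W ε) : dagger ε (w * w') = dagger ε w' * dagger ε w := by
  unfold dagger
  rw [map_mul]
  rfl

theorem dagger_algebraMap (ε : ℝ) (c : ℂ) :
    dagger ε (algebraMap ℂ (W ε) c) = algebraMap ℂ (W ε) (starRingEnd ℂ c) := by
  unfold dagger
  rw [AlgHom.commutes]
  rfl

/-! ### Totally symmetric polynomials and the formal trace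

A finitely supported function on words is a formal polynomial in the four letters. The ones that
are invariant under every permutation of the letters of a word are the totally symmetric
polynomials; they do not depend on `ε`. -/

/-- The totally symmetric formal polynomials in `a₊, a₋, b₊, b₋`. -/
def Sym : Submodule ℂ (List Gen →₀ ℂ) where
  carrier := {t | ∀ l l' : List Gen, l.Perm l' → t l = t l'}
  add_mem' := by
    intro s t hs ht l l' h
    simp [hs l l' h, ht l l' h]
  zero_mem' := by
    intro l l' _
    rfl
  smul_mem' := by
    intro c t ht l l' h
    simp [ht l l' h]

/-- The coefficients of the formal trace `w₁ + w₂ + w₃ + w₄` of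
`w₁ a₊ a₋ + w₂ a₋ a₊ + w₃ b₊ b₋ + w₄ b₋ b₊ + w₅ a₊² + ⋯`, the words being sorted by their last
two letters. -/
def trCoeff (t : List Gen →₀ ℂ) (l : List Gen) : ℂ :=
  t (l ++ [.ap, .am]) + t (l ++ [.am, .ap]) + t (l ++ [.bp, .bm]) + t (l ++ [.bm, .bp])

/-- The totally symmetric formal polynomials whose formal trace vanishes. -/
def SymTraceless : Submodule ℂ (List Gen →₀ ℂ) where
  carrier := {t | t ∈ Sym ∧ ∀ l, trCoeff t l = 0}
  add_mem' := by
    rintro s t ⟨hs, hs'⟩ ⟨ht, ht'⟩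
    refine ⟨Sym.add_mem hs ht, fun l => ?_⟩
    have e : trCoeff (s + t) l = trCoeff s l + trCoeff t l := by
      simp only [trCoeff, Finsupp.add_apply]
      ring
    rw [e, hs', ht', add_zero]
  zero_mem' := ⟨Sym.zero_mem, fun l => by simp [trCoeff]⟩
  smul_mem' := by
    rintro c t ⟨ht, ht'⟩
    refine ⟨Sym.smul_mem c ht, fun l => ?_⟩
    have e : trCoeff (c • t) l = c * trCoeff t l := by
      simp only [trCoeff, Finsupp.smul_apply, smul_eq_mul]
      ring
    rw [e, ht', mul_zero]

/-- The element of `𝒲(ε)` given by a formal polynomial. -/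
def toW (ε : ℝ) : (List Gen →₀ ℂ) →ₗ[ℂ] W ε :=
  Finsupp.linearCombination ℂ (fun l : List Gen => (l.map (gen ε)).prod)

/-- The subspace `Ψ` of `𝒲(ε)` of all formally traceless symmetric polynomials. -/
def Psi (ε : ℝ) : Submodule ℂ (W ε) := SymTraceless.map (toW ε)

/-- The adjoint `Ad_T (w) = [T, w]`. -/
def Ad (ε : ℝ) (T : W ε) : Module.End ℂ (W ε) := LinearMap.mulLeft ℂ T - LinearMap.mulRight ℂ T

/-- The subspace `Ψ_r` of those `ξ ∈ Ψ` with `Ad_{K₀} ξ = ε r ξ`. -/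
def PsiR (ε r : ℝ) : Submodule ℂ (W ε) :=
  Psi ε ⊓ Module.End.eigenspace (Ad ε (K0 ε)) ((ε * r : ℝ) : ℂ)

/-! ### The projection `ρ` -/

/-- `R̂ = (R² + ε² / 4)^{1/2}`. -/
def Rhat (R ε : ℝ) : ℝ := √(R ^ 2 + ε ^ 2 / 4)

/-- The left ideal `{w (K₀ - R̂) | w ∈ 𝒲}`. -/
def kerRho (R ε : ℝ) : Submodule ℂ (W ε) :=
  LinearMap.range (LinearMap.mulRight ℂ (K0 ε - algebraMap ℂ (W ε) (Rhat R ε : ℂ)))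

open Classical in
/-- The projection `ρ_R : 𝒲 → Ψ` with kernel `{w (K₀ - R̂) | w ∈ 𝒲}`. These two subspaces are
complementary, so the value `0` in the other case is never used. -/
def rho (R ε : ℝ) : W ε →ₗ[ℂ] W ε :=
  if h : IsCompl (Psi ε) (kerRho R ε) then (Psi ε).projection (kerRho R ε) h else 0

/-! ### The basis and the exterior derivative -/

/-- The basis element `P(n,r,m) = ε^{m-n} ((n+m)! / ((2n)! (n-m)!))^{1/2}
(Ad_{J₋})^{n-m} (a₊^{n+r} b₋^{n-r})`, for `n ≥ 0`, `|r| ≤ n`, `|m| ≤ n` with `2n`, `n + r` and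
`n + m` integers (so that the exponents are natural numbers), and for `ε ≠ 0`. -/
def P (ε : ℝ) (n r m : ℚ) : W ε :=
  (((ε ^ ⌊n - m⌋₊)⁻¹ *
      √((⌊n + m⌋₊.factorial : ℝ) / ((⌊2 * n⌋₊.factorial : ℝ) * (⌊n - m⌋₊.factorial : ℝ))) :
        ℝ) : ℂ) •
    ((Ad ε (Jm ε)) ^ ⌊n - m⌋₊) (gen ε .ap ^ ⌊n + r⌋₊ * gen ε .bm ^ ⌊n - r⌋₊)

/-- `ω^{r₁ r₂}_n (ξ) = ∑_{m = -n}^{n} ρ(P(n,r₂,m)† ξ P(n,r₁,m))`, with `m = j - n`. -/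
def omega (R ε : ℝ) (r₁ r₂ n : ℚ) (ξ : W ε) : W ε :=
  ∑ j ∈ Finset.range (⌊2 * n⌋₊ + 1),
    rho R ε (dagger ε (P ε n r₂ ((j : ℚ) - n)) * ξ * P ε n r₁ ((j : ℚ) - n))

/-- The normalised coordinates `x^m = (2R̂ + ε)^{-1/2} P(1,0,m)`, `m ∈ {-1, 0, 1}`. -/
def x (R ε : ℝ) (m : ℤ) : W ε := (((√(2 * Rhat R ε + ε))⁻¹ : ℝ) : ℂ) • P ε 1 0 m

/-- The basis 1-forms `dx^m = (2R̂ + ε)^{-1/2} P(1,-1,m)`, `m ∈ {-1, 0, 1}`. -/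
def dx (R ε : ℝ) (m : ℤ) : W ε := (((√(2 * Rhat R ε + ε))⁻¹ : ℝ) : ℂ) • P ε 1 (-1) m

/-- The exterior derivative `d f = ε⁻¹ (2R̂ + ε)⁻¹ ω^{01}_1 (f)`. -/
def d (R ε : ℝ) (f : W ε) : W ε := ((ε⁻¹ * (2 * Rhat R ε + ε)⁻¹ : ℝ) : ℂ) • omega R ε 0 1 1 f

end FuzzySphere

end

noncomputable section

namespace FuzzySphere

open MvPolynomial Filter Topology Asymptotics

/-! Everything is transported to commutative polynomials by the Weyl symbol. The algebra acts on
`Poly` by the Moyal operators `leftOp`, and applying an element to `1` gives the linear bijection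
`symbol`, under which a totally symmetric polynomial becomes its commutative image (`symbol_toW`).
Formal tracelessness becomes harmonicity for `lap`, `Ad` of `K0` becomes `(ε/2) • weight`, `Ad` of
`Jm` becomes `ε • rotate`, and right multiplication by `2 (K₀ - R̂)` becomes `shiftOp`. The Fischer
decomposition `p = h + quad * p'` with `h` harmonic then shows that `rho` is a genuine projection
and gives the recursion `rhoSymbol_quad_mul` for computing it.

For part (1), the three summands of `omega` factor (`omega_eq`) into a sandwich, with symbol `quad *
p + (ε/2)(euler p + 2p)` on harmonic `p`, followed by an antisymmetrised product, with symbol `ε •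
lower`. Reducing `quad` modulo the kernel yields the exact formula `symbol_d`: on weight zero, `d`
is `lower ∘ (2R̂ + (ε/2) euler)` divided by `2R̂ + ε`. As `rotate` commutes with `lower` and
`euler`, it suffices to evaluate this on `a₊ⁿ b₋ⁿ`.

For part (2), `d = lower + O(ε)` on symbols and `lower` is a derivation. The product of symbols is
the commutative one up to `O(ε)` (`star_sub_mul_mem_family`), and `lower` commutes with `rhoSymbol`
up to `O(ε)` (`lower_rhoSymbol_sub_mem_family`). The submodules `family k` make the error terms
uniform: finitely many fixed polynomials with coefficients `O(ε ^ k)`. -/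

instance : Finite Gen :=
  Set.finite_univ_iff.mp ((Set.toFinite {Gen.ap, Gen.am, Gen.bp, Gen.bm}).subset
    fun g _ => by cases g <;> simp)

@[simp]
theorem Gen.flip_flip (g : Gen) : g.flip.flip = g := by cases g <;> rfl

/-- The commutative polynomials in the four letters. -/
abbrev Poly : Type := MvPolynomial Gen ℂ

/-! ### Partial derivatives -/

theorem pderiv_pderiv_comm (g h : Gen) (p : Poly) :
    pderiv g (pderiv h p) = pderiv h (pderiv g p) := by
  classical
  ext s
  simp only [coeff_pderiv, Finsupp.add_apply, Finsupp.single_apply]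
  rw [add_right_comm]
  by_cases e : g = h
  · subst e; ring
  · simp [e, Ne.symm e]; ring

theorem eq_C_of_pderiv_eq_zero {p : Poly} (h : ∀ g, pderiv g p = 0) : p = C (coeff 0 p) := by
  classical
  ext s
  rw [coeff_C]
  split_ifs with hs
  · rw [hs]
  · obtain ⟨g, hg⟩ : ∃ g, s g ≠ 0 := by
      by_contra! hc
      exact hs (Finsupp.ext fun g => (hc g).symm)
    have := congrArg (coeff (s - Finsupp.single g 1)) (h g)
    rw [coeff_pderiv, coeff_zero,
      tsub_add_cancel_of_le (Finsupp.single_le_iff.mpr (Nat.one_le_iff_ne_zero.mpr hg))] at this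
    exact (mul_eq_zero.mp this).resolve_right (Nat.cast_add_one_ne_zero _)

/-- The polynomials of degree less than `n`. -/
def DegLT (n : ℕ) : Submodule ℂ Poly where
  carrier := {p | ∀ s : Gen →₀ ℕ, n ≤ s.degree → coeff s p = 0}
  add_mem' hp hq s hs := by rw [coeff_add, hp s hs, hq s hs, add_zero]
  zero_mem' _ _ := coeff_zero _
  smul_mem' c p hp s hs := by rw [coeff_smul, hp s hs, smul_zero]

theorem exists_mem_degLT (p : Poly) : ∃ n, p ∈ DegLT n :=
  ⟨p.totalDegree + 1, fun s hs => coeff_eq_zero_of_totalDegree_lt (by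
    rw [← Finsupp.degree_apply]; omega)⟩

theorem eq_zero_of_mem_degLT_zero {p : Poly} (hp : p ∈ DegLT 0) : p = 0 :=
  MvPolynomial.ext _ _ fun s => hp s (Nat.zero_le _)

theorem pderiv_mem_degLT {n : ℕ} {p : Poly} (hp : p ∈ DegLT (n + 1)) (g : Gen) :
    pderiv g p ∈ DegLT n := fun s hs => by
  rw [coeff_pderiv, hp, zero_mul]
  rw [map_add, Finsupp.degree_single]
  omega

theorem degLT_mono {m n : ℕ} (h : m ≤ n) : DegLT m ≤ DegLT n :=
  fun _ hp s hs => hp s (h.trans hs)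

/-- Differentiation lowers the degree. With `eq_C_of_pderiv_eq_zero`, this reduces identities to
their partial derivatives and one constant. -/
theorem pderiv_induction {motive : Poly → Prop} (zero : motive 0)
    (step : ∀ p, (∀ g, motive (pderiv g p)) → motive p) (p : Poly) : motive p := by
  obtain ⟨n, hn⟩ := exists_mem_degLT p
  induction n generalizing p with
  | zero => rw [eq_zero_of_mem_degLT_zero hn]; exact zero
  | succ n ih => exact step p fun g => ih _ (pderiv_mem_degLT hn g)

/-- The iterated partial derivative along the letters of a word. -/
def pderivWord (l : List Gen) : Poly →ₗ[ℂ] Poly :=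
  l.foldl (fun T g => (pderiv g).toLinearMap ∘ₗ T) LinearMap.id

theorem foldl_pderiv (l : List Gen) (T : Poly →ₗ[ℂ] Poly) :
    l.foldl (fun T g => (pderiv g).toLinearMap ∘ₗ T) T = pderivWord l ∘ₗ T := by
  induction l generalizing T with
  | nil => rfl
  | cons g l ih =>
    rw [pderivWord, List.foldl_cons, List.foldl_cons, ih, ih, LinearMap.comp_id,
      LinearMap.comp_assoc]

theorem pderivWord_cons (g : Gen) (l : List Gen) (p : Poly) :
    pderivWord (g :: l) p = pderivWord l (pderiv g p) := by
  rw [pderivWord, List.foldl_cons, foldl_pderiv]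
  rfl

theorem pderivWord_perm {l l' : List Gen} (h : l.Perm l') : pderivWord l = pderivWord l' := by
  refine LinearMap.ext fun p => ?_
  induction h generalizing p with
  | nil => rfl
  | cons g _ ih => rw [pderivWord_cons, pderivWord_cons, ih]
  | swap g h l => simp only [pderivWord_cons, pderiv_pderiv_comm g h]
  | trans _ _ ih ih' => rw [ih, ih']

theorem exists_pderivWord_eq_zero (p : Poly) :
    ∃ n, ∀ l : List Gen, n ≤ l.length → pderivWord l p = 0 := by
  obtain ⟨n, hn⟩ := exists_mem_degLT p
  refine ⟨n, fun l hl => ?_⟩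
  induction l generalizing p n with
  | nil =>
    obtain rfl : n = 0 := by simpa using hl
    rw [eq_zero_of_mem_degLT_zero hn, map_zero]
  | cons g l ih =>
    rw [pderivWord_cons]
    rw [List.length_cons] at hl
    exact ih _ _ (pderiv_mem_degLT (degLT_mono hl hn) g) le_rfl

/-! ### Symmetric words and polynomials -/

/-- The evaluation of formal polynomials at elements of an algebra. -/
def ev {B : Type*} [Ring B] [Algebra ℂ B] (f : Gen → B) : (List Gen →₀ ℂ) →ₗ[ℂ] B :=
  Finsupp.linearCombination ℂ (fun l : List Gen => (l.map f).prod)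

/-- The coefficients of the words that begin with `g`, without this letter. -/
def behead (g : Gen) (t : List Gen →₀ ℂ) : List Gen →₀ ℂ :=
  t.comapDomain (List.cons g) (List.cons_injective.injOn)

@[simp]
theorem behead_apply (g : Gen) (t : List Gen →₀ ℂ) (l : List Gen) :
    behead g t l = t (g :: l) := rfl

/-- Sorting words by their first letter. Combined with `sym_induction`, this allows inductions that
never mention individual words. -/
theorem ev_eq {B : Type*} [Ring B] [Algebra ℂ B] (f : Gen → B) (t : List Gen →₀ ℂ) :
    ev f t = algebraMap ℂ B (t []) + (f .ap * ev f (behead .ap t) + f .am * ev f (behead .am t) +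
      f .bp * ev f (behead .bp t) + f .bm * ev f (behead .bm t)) := by
  have hadd : ∀ g s t, behead g (s + t) = behead g s + behead g t := fun _ _ _ => by
    ext; rfl
  induction t using Finsupp.induction_linear with
  | zero =>
    have h : ∀ g, behead g 0 = 0 := fun _ => by ext; rfl
    simp [h]
  | add s t hs ht =>
    simp only [map_add, hs, ht, hadd, Finsupp.add_apply, mul_add]
    abel
  | single l c =>
    rcases l with - | ⟨g, l⟩
    · have h : ∀ g, behead g (Finsupp.single [] c) = 0 := fun g => by
        ext l; simp
      simp [h, ev, Finsupp.linearCombination_single, Algebra.algebraMap_eq_smul_one]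
    · have h : ∀ g', g' ≠ g → behead g' (Finsupp.single (g :: l) c) = 0 := fun g' hg => by
        ext l'
        classical
        simp [Ne.symm hg]
      have h' : behead g (Finsupp.single (g :: l) c) = Finsupp.single l c := by
        ext l'
        classical
        simp [Finsupp.single_apply]
      cases g <;>
      simp [h', h, ev, Finsupp.linearCombination_single]

theorem behead_mem_sym {t : List Gen →₀ ℂ} (ht : t ∈ Sym) (g : Gen) : behead g t ∈ Sym :=
  fun _ _ h => ht _ _ (h.cons g)

theorem sym_induction {motive : (List Gen →₀ ℂ) → Prop} (zero : motive 0)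
    (step : ∀ t ∈ Sym, (∀ g, motive (behead g t)) → motive t) {t : List Gen →₀ ℂ}
    (ht : t ∈ Sym) : motive t := by
  obtain ⟨n, hn⟩ : ∃ n, ∀ l : List Gen, n ≤ l.length → t l = 0 := by
    refine ⟨t.support.sup List.length + 1, fun l hl => ?_⟩
    by_contra h
    have := Finset.le_sup (f := List.length) (Finsupp.mem_support_iff.mpr h)
    omega
  induction n generalizing t with
  | zero =>
    obtain rfl : t = 0 := Finsupp.ext fun l => hn l (Nat.zero_le _)
    exact zero
  | succ n ih =>
    exact step t ht fun g => ih (behead_mem_sym ht g) fun l hl => hn _ (by simpa using hl)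

/-- The formal polynomial with every coefficient multiplied by the length of the word. -/
def lengthMul (t : List Gen →₀ ℂ) : List Gen →₀ ℂ :=
  Finsupp.onFinset t.support (fun l => (l.length : ℂ) * t l) fun _ hl =>
    Finsupp.mem_support_iff.mpr (right_ne_zero_of_mul hl)

/-- The partial derivative of a symmetric formal polynomial. -/
def wordDeriv (g : Gen) (t : List Gen →₀ ℂ) : List Gen →₀ ℂ := behead g (lengthMul t)

@[simp]
theorem wordDeriv_apply (g : Gen) (t : List Gen →₀ ℂ) (l : List Gen) :
    wordDeriv g t l = (l.length + 1) * t (g :: l) := by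
  change (((g :: l).length : ℕ) : ℂ) * t (g :: l) = _
  simp

theorem wordDeriv_mem_sym {t : List Gen →₀ ℂ} (ht : t ∈ Sym) (g : Gen) : wordDeriv g t ∈ Sym := by
  intro _ _ h
  rw [wordDeriv_apply, wordDeriv_apply, h.length_eq, ht _ _ (h.cons g)]

/-- The commutative image of a formal polynomial. -/
abbrev comm : (List Gen →₀ ℂ) →ₗ[ℂ] Poly := ev X

theorem behead_wordDeriv {t : List Gen →₀ ℂ} (ht : t ∈ Sym) (g h : Gen) :
    behead g (wordDeriv h t) = wordDeriv h (behead g t) + behead g (behead h t) := by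
  ext l
  simp only [behead_apply, wordDeriv_apply, Finsupp.add_apply, List.length_cons]
  rw [ht (h :: g :: l) (g :: h :: l) (List.Perm.swap _ _ _)]
  push_cast
  ring

/-- A derivative deletes one occurrence of `h` from each word. By symmetry every position
contributes equally, which accounts for the factor `l.length + 1` in `wordDeriv`. -/
theorem pderiv_comm {t : List Gen →₀ ℂ} (ht : t ∈ Sym) (h : Gen) :
    pderiv h (comm t) = comm (wordDeriv h t) := by
  refine sym_induction (motive := fun t => pderiv h (comm t) = comm (wordDeriv h t)) ?_ ?_ ht
  · have : wordDeriv h 0 = 0 := by ext; simp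
    simp [this]
  · intro t ht ih
    rw [comm, ev_eq, ev_eq X (wordDeriv h t)]
    have e := ev_eq (X : Gen → Poly) (behead h t)
    simp only [map_add, Derivation.leibniz, ih, behead_wordDeriv ht, smul_eq_mul,
      MvPolynomial.algebraMap_eq, pderiv_C, wordDeriv_apply, List.length_nil, behead_apply,
      Nat.cast_zero, zero_add, one_mul] at e ⊢
    have hX : X .ap * comm (behead .ap (behead h t)) + X .am * comm (behead .am (behead h t)) +
      X .bp * comm (behead .bp (behead h t)) + X .bm * comm (behead .bm (behead h t)) +
      C (t [h]) = comm (behead h t) := by rw [e]; ring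
    have hd : comm (behead .ap t) * pderiv h (X .ap) + comm (behead .am t) * pderiv h (X .am) +
        comm (behead .bp t) * pderiv h (X .bp) + comm (behead .bm t) * pderiv h (X .bm) =
        comm (behead h t) := by cases h <;> simp
    linear_combination hd - hX

theorem comm_coeff_zero (t : List Gen →₀ ℂ) : coeff 0 (comm t) = t [] := by
  rw [comm, ev_eq, ← constantCoeff_eq]
  simp [MvPolynomial.algebraMap_eq]

theorem eq_zero_of_comm_eq_zero {t : List Gen →₀ ℂ} (ht : t ∈ Sym) (h : comm t = 0) : t = 0 := by
  ext l
  induction l generalizing t with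
  | nil => rw [← comm_coeff_zero, h]; rfl
  | cons g l ih =>
    have := ih (wordDeriv_mem_sym ht g) (by rw [← pderiv_comm ht, h, map_zero])
    rw [wordDeriv_apply] at this
    exact (mul_eq_zero.mp this).resolve_left (Nat.cast_add_one_ne_zero _)

/-- The symmetric formal polynomial with a given commutative image. -/
def symm : Poly →ₗ[ℂ] (List Gen →₀ ℂ) where
  toFun p := Finsupp.ofSupportFinite
    -- Taylor's formula at the origin, each coefficient being shared equally among the
    -- rearrangements of its word.
    (fun l => ((l.length.factorial : ℂ))⁻¹ * coeff 0 (pderivWord l p)) (by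
      obtain ⟨n, hn⟩ := exists_pderivWord_eq_zero p
      refine (List.finite_length_lt Gen n).subset fun l hl => ?_
      by_contra h
      exact hl (by simp [hn l (not_lt.mp h)]))
  map_add' p q := by ext l; simp [Finsupp.ofSupportFinite_coe, mul_add]
  map_smul' c p := by ext l; simp [Finsupp.ofSupportFinite_coe]; ring

theorem symm_apply (p : Poly) (l : List Gen) :
    symm p l = ((l.length.factorial : ℂ))⁻¹ * coeff 0 (pderivWord l p) := rfl

theorem symm_mem_sym (p : Poly) : symm p ∈ Sym := fun l l' h => by
  rw [symm_apply, symm_apply, h.length_eq, pderivWord_perm h]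

theorem wordDeriv_symm (g : Gen) (p : Poly) : wordDeriv g (symm p) = symm (pderiv g p) := by
  ext l
  have h : (l.length : ℂ) + 1 ≠ 0 := Nat.cast_add_one_ne_zero _
  have h' : (l.length.factorial : ℂ) ≠ 0 := Nat.cast_ne_zero.mpr (Nat.factorial_ne_zero _)
  rw [wordDeriv_apply, symm_apply, symm_apply, pderivWord_cons, List.length_cons,
    Nat.factorial_succ]
  push_cast
  field_simp

@[simp]
theorem comm_symm (p : Poly) : comm (symm p) = p := by
  induction p using pderiv_induction with
  | zero => simp
  | step p ih =>
    have h : ∀ g, pderiv g (comm (symm p) - p) = 0 := fun g => by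
      rw [map_sub, pderiv_comm (symm_mem_sym p), wordDeriv_symm, ih, sub_self]
    have e := eq_C_of_pderiv_eq_zero h
    rw [coeff_sub, comm_coeff_zero, symm_apply] at e
    simpa [pderivWord, sub_eq_zero] using e

/-- The Laplace operator `∂²/∂a₊∂a₋ + ∂²/∂b₊∂b₋`. -/
def lap : Module.End ℂ Poly :=
  (pderiv Gen.ap).toLinearMap ∘ₗ (pderiv Gen.am).toLinearMap +
    (pderiv Gen.bp).toLinearMap ∘ₗ (pderiv Gen.bm).toLinearMap

theorem lap_apply (p : Poly) :
    lap p = pderiv .ap (pderiv .am p) + pderiv .bp (pderiv .bm p) := rfl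

theorem trCoeff_eq {t : List Gen →₀ ℂ} (ht : t ∈ Sym) (l : List Gen) :
    trCoeff t l = 2 * (t (.am :: .ap :: l) + t (.bm :: .bp :: l)) := by
  have h : ∀ g h : Gen, t (l ++ [g, h]) = t (g :: h :: l) := fun g h =>
    ht _ _ List.perm_append_comm
  have h' : ∀ g h : Gen, t (l ++ [h, g]) = t (g :: h :: l) := fun g k =>
    (h k g).trans (ht _ _ (List.Perm.swap _ _ _))
  rw [trCoeff, h .am .ap, h .bm .bp, h' .am .ap, h' .bm .bp]
  ring

/-- Symmetry moves the last two letters to the front and pairs the four terms of the trace, so the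
trace coefficient at `l` is that of the Laplacian up to the nonzero factor `(|l| + 1)(|l| + 2) / 2`.
-/
theorem mem_symTraceless_iff {t : List Gen →₀ ℂ} (ht : t ∈ Sym) :
    t ∈ SymTraceless ↔ lap (comm t) = 0 := by
  have hs : ∀ g h, wordDeriv g (wordDeriv h t) ∈ Sym := fun g h =>
    wordDeriv_mem_sym (wordDeriv_mem_sym ht h) g
  have e : lap (comm t) =
      comm (wordDeriv .ap (wordDeriv .am t) + wordDeriv .bp (wordDeriv .bm t)) := by
    simp only [lap_apply, pderiv_comm ht, pderiv_comm (wordDeriv_mem_sym ht _), map_add]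
  have e' : ∀ l, (wordDeriv .ap (wordDeriv .am t) + wordDeriv .bp (wordDeriv .bm t)) l =
      (l.length + 1) * (((l.length + 1 : ℕ) : ℂ) + 1) / 2 * trCoeff t l := fun l => by
    simp [trCoeff_eq ht]
    ring
  rw [e]
  constructor
  · intro h
    have : wordDeriv .ap (wordDeriv .am t) + wordDeriv .bp (wordDeriv .bm t) = 0 := by
      ext l
      rw [e', h.2, mul_zero]
      rfl
    rw [this, map_zero]
  · intro h
    have := eq_zero_of_comm_eq_zero (Sym.add_mem (hs _ _) (hs _ _)) h
    refine ⟨ht, fun l => ?_⟩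
    have h1 := e' l
    rw [this] at h1
    refine (mul_eq_zero.mp h1.symm).resolve_left ?_
    exact div_ne_zero (mul_ne_zero (Nat.cast_add_one_ne_zero _) (Nat.cast_add_one_ne_zero _))
      two_ne_zero

/-! ### Differential operators on polynomials -/

/-- The invariant quadratic polynomial `a₊ a₋ + b₊ b₋`. -/
def quad : Poly := X .ap * X .am + X .bp * X .bm

/-- The Euler operator. -/
def euler : Module.End ℂ Poly :=
  LinearMap.mulLeft ℂ (X .ap) ∘ₗ (pderiv Gen.ap).toLinearMap +
  LinearMap.mulLeft ℂ (X .am) ∘ₗ (pderiv Gen.am).toLinearMap +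
  LinearMap.mulLeft ℂ (X .bp) ∘ₗ (pderiv Gen.bp).toLinearMap +
  LinearMap.mulLeft ℂ (X .bm) ∘ₗ (pderiv Gen.bm).toLinearMap

/-- The derivation that counts `a₊` and `b₊` positively, `a₋` and `b₋` negatively. -/
def weight : Module.End ℂ Poly :=
  LinearMap.mulLeft ℂ (X .ap) ∘ₗ (pderiv Gen.ap).toLinearMap -
  LinearMap.mulLeft ℂ (X .am) ∘ₗ (pderiv Gen.am).toLinearMap +
  LinearMap.mulLeft ℂ (X .bp) ∘ₗ (pderiv Gen.bp).toLinearMap -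
  LinearMap.mulLeft ℂ (X .bm) ∘ₗ (pderiv Gen.bm).toLinearMap

/-- The derivation `a₊ ↦ b₋`, `b₊ ↦ -a₋`, the classical limit of the exterior derivative. -/
def lower : Module.End ℂ Poly :=
  LinearMap.mulLeft ℂ (X .bm) ∘ₗ (pderiv Gen.ap).toLinearMap -
  LinearMap.mulLeft ℂ (X .am) ∘ₗ (pderiv Gen.bp).toLinearMap

/-- The derivation `a₊ ↦ b₊`, `b₋ ↦ -a₋`, the symbol of `ε⁻¹ Ad_{J₋}`. -/
def rotate : Module.End ℂ Poly :=
  LinearMap.mulLeft ℂ (X .bp) ∘ₗ (pderiv Gen.ap).toLinearMap -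
  LinearMap.mulLeft ℂ (X .am) ∘ₗ (pderiv Gen.bm).toLinearMap

theorem euler_apply (p : Poly) : euler p = X .ap * pderiv .ap p + X .am * pderiv .am p +
    X .bp * pderiv .bp p + X .bm * pderiv .bm p := rfl

theorem weight_apply (p : Poly) : weight p = X .ap * pderiv .ap p - X .am * pderiv .am p +
    X .bp * pderiv .bp p - X .bm * pderiv .bm p := rfl

theorem lower_apply (p : Poly) : lower p = X .bm * pderiv .ap p - X .am * pderiv .bp p := rfl

theorem rotate_apply (p : Poly) : rotate p = X .bp * pderiv .ap p - X .am * pderiv .bm p := rfl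

theorem pderiv_am_ap (p : Poly) : pderiv .am (pderiv .ap p) = pderiv .ap (pderiv .am p) :=
  pderiv_pderiv_comm _ _ _

theorem pderiv_bp_ap (p : Poly) : pderiv .bp (pderiv .ap p) = pderiv .ap (pderiv .bp p) :=
  pderiv_pderiv_comm _ _ _

theorem pderiv_bm_ap (p : Poly) : pderiv .bm (pderiv .ap p) = pderiv .ap (pderiv .bm p) :=
  pderiv_pderiv_comm _ _ _

theorem pderiv_bp_am (p : Poly) : pderiv .bp (pderiv .am p) = pderiv .am (pderiv .bp p) :=
  pderiv_pderiv_comm _ _ _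

theorem pderiv_bm_am (p : Poly) : pderiv .bm (pderiv .am p) = pderiv .am (pderiv .bm p) :=
  pderiv_pderiv_comm _ _ _

theorem pderiv_bm_bp (p : Poly) : pderiv .bm (pderiv .bp p) = pderiv .bp (pderiv .bm p) :=
  pderiv_pderiv_comm _ _ _

section

set_option linter.unusedSimpArgs false

/-- The `sl₂` relation behind the Fischer decomposition; the constant 2 is half the number of
variables. -/
theorem lap_quad (p : Poly) : lap (quad * p) = quad * lap p + euler p + p + p := by
  simp [lap_apply, euler_apply, quad, pderiv_am_ap, pderiv_bm_bp]
  ring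

theorem lap_euler (p : Poly) : lap (euler p) = euler (lap p) + lap p + lap p := by
  simp [lap_apply, euler_apply, pderiv_am_ap, pderiv_bp_ap, pderiv_bm_ap, pderiv_bp_am,
    pderiv_bm_am, pderiv_bm_bp]
  ring

theorem lap_weight (p : Poly) : lap (weight p) = weight (lap p) := by
  simp [lap_apply, weight_apply, pderiv_am_ap, pderiv_bp_ap, pderiv_bm_ap, pderiv_bp_am,
    pderiv_bm_am, pderiv_bm_bp]
  ring

theorem lap_lower (p : Poly) : lap (lower p) = lower (lap p) := by
  simp [lap_apply, lower_apply, pderiv_am_ap, pderiv_bp_ap, pderiv_bm_ap, pderiv_bp_am,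
    pderiv_bm_am, pderiv_bm_bp]
  ring

theorem lap_rotate (p : Poly) : lap (rotate p) = rotate (lap p) := by
  simp [lap_apply, rotate_apply, pderiv_am_ap, pderiv_bp_ap, pderiv_bm_ap, pderiv_bp_am,
    pderiv_bm_am, pderiv_bm_bp]
  ring

theorem euler_rotate (p : Poly) : euler (rotate p) = rotate (euler p) := by
  simp [euler_apply, rotate_apply, pderiv_am_ap, pderiv_bp_ap, pderiv_bm_ap, pderiv_bp_am,
    pderiv_bm_am, pderiv_bm_bp]
  ring

theorem weight_euler (p : Poly) : weight (euler p) = euler (weight p) := by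
  simp [weight_apply, euler_apply, pderiv_am_ap, pderiv_bp_ap, pderiv_bm_ap, pderiv_bp_am,
    pderiv_bm_am, pderiv_bm_bp]
  ring

theorem weight_lower (p : Poly) : weight (lower p) = lower (weight p) - lower p - lower p := by
  simp [weight_apply, lower_apply, pderiv_am_ap, pderiv_bp_ap, pderiv_bm_ap, pderiv_bp_am,
    pderiv_bm_am, pderiv_bm_bp]
  ring

theorem weight_rotate (p : Poly) : weight (rotate p) = rotate (weight p) := by
  simp [weight_apply, rotate_apply, pderiv_am_ap, pderiv_bp_ap, pderiv_bm_ap, pderiv_bp_am,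
    pderiv_bm_am, pderiv_bm_bp]
  ring

/-- Both derivations annihilate `quad`. They lie in different factors of `so(4) = sl₂ × sl₂`:
`lower` and `weight` in one, `rotate` in the other. -/
theorem lower_rotate (p : Poly) : lower (rotate p) = rotate (lower p) := by
  simp [lower_apply, rotate_apply, pderiv_am_ap, pderiv_bp_ap, pderiv_bm_ap, pderiv_bp_am,
    pderiv_bm_am, pderiv_bm_bp]
  ring

theorem weight_quad_mul (p : Poly) : weight (quad * p) = quad * weight p := by
  simp [weight_apply, quad]
  ring

theorem lower_quad_mul (p : Poly) : lower (quad * p) = quad * lower p := by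
  simp [lower_apply, quad]
  ring

theorem lower_mul (p r : Poly) : lower (p * r) = lower p * r + p * lower r := by
  simp [lower_apply]
  ring

end

theorem coeff_euler (s : Gen →₀ ℕ) (p : Poly) : coeff s (euler p) = s.degree * coeff s p := by
  classical
  induction p using MvPolynomial.induction_on' with
  | add p q hp hq => rw [map_add, coeff_add, coeff_add, hp, hq, mul_add]
  | monomial u a =>
    have hd : u.degree = u .ap + u .am + u .bp + u .bm := by
      have h : u.support ⊆ {.ap, .am, .bp, .bm} := fun g _ => by cases g <;> simp
      rw [Finsupp.degree_apply, Finset.sum_subset h (by simp)]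
      simp [add_assoc]
    rw [euler_apply]
    simp only [X_mul_pderiv_monomial, ← add_smul]
    rw [coeff_smul, coeff_monomial]
    split_ifs with h
    · rw [← h, hd, nsmul_eq_mul]
    · simp

/-! ### Harmonic decomposition -/

theorem exists_lap_pow_eq_zero (p : Poly) : ∃ k, (lap ^ k) p = 0 := by
  obtain ⟨n, hn⟩ := exists_mem_degLT p
  refine ⟨n, ?_⟩
  induction n generalizing p with
  | zero => rw [eq_zero_of_mem_degLT_zero hn, map_zero]
  | succ n ih =>
    have hd : ∀ g h, pderiv g (pderiv h p) ∈ DegLT n := fun g h =>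
      pderiv_mem_degLT (degLT_mono (Nat.le_succ _) (pderiv_mem_degLT hn h)) g
    rw [pow_succ, Module.End.mul_apply]
    exact ih _ ((DegLT n).add_mem (hd _ _) (hd _ _))

/-- On monomials `euler` is diagonal with the degree as eigenvalue, so the operator acts by the
positive numbers `c + j * degree`. -/
theorem exists_smul_add_euler_eq {c : ℕ} (hc : 0 < c) (j : ℕ) (r : Poly) :
    ∃ p, c • p + j • euler p = r := by
  classical
  induction r using MvPolynomial.induction_on' with
  | add r r' hr hr' =>
    obtain ⟨p, rfl⟩ := hr
    obtain ⟨p', rfl⟩ := hr'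
    exact ⟨p + p', by rw [map_add, smul_add, smul_add]; abel⟩
  | monomial u a =>
    refine ⟨monomial u ((c + j * u.degree : ℂ)⁻¹ * a), ?_⟩
    have hne : (c + j * u.degree : ℂ) ≠ 0 := by
      exact_mod_cast (by positivity : c + j * u.degree ≠ 0)
    ext s
    simp only [coeff_add, coeff_smul, coeff_euler, coeff_monomial]
    split_ifs with h
    · subst h
      simp only [nsmul_eq_mul]
      field_simp
    · simp

theorem eq_zero_of_smul_add_euler_eq_zero {c : ℕ} (hc : 0 < c) (j : ℕ) {p : Poly}
    (h : c • p + j • euler p = 0) : p = 0 := by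
  ext s
  have := congrArg (coeff s) h
  simp only [coeff_add, coeff_smul, coeff_euler, coeff_zero] at this
  rw [nsmul_eq_mul, nsmul_eq_mul, ← mul_assoc, ← add_mul] at this
  refine (mul_eq_zero.mp this).resolve_left ?_
  exact_mod_cast (by positivity : c + j * s.degree ≠ 0)

theorem lap_smul_add_euler (c j : ℕ) (p : Poly) :
    lap (c • p + j • euler p) = (c + 2 * j) • lap p + j • euler (lap p) := by
  rw [map_add, map_nsmul, map_nsmul, lap_euler]
  module

/-- Applying `lap` turns the equation for `p` with parameters `(c, j)` into the same equation for
`lap p` with `(c + 2j + 2, j + 1)`, and lowers `k`. This is why general `c` and `j` are carried;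
only `(2, 1)`, the operator `lap ∘ quad`, is needed later. -/
theorem exists_smul_add_euler_add_quad_lap_eq (k : ℕ) {c : ℕ} (hc : 0 < c) (j : ℕ) {r : Poly}
    (hr : (lap ^ k) r = 0) :
    ∃ p, (lap ^ k) p = 0 ∧ c • p + j • euler p + quad * lap p = r := by
  induction k generalizing c j r with
  | zero => exact ⟨0, by simp, by simpa using hr.symm⟩
  | succ k ih =>
    rw [pow_succ, Module.End.mul_apply] at hr
    obtain ⟨p₁, h₁, h₂⟩ := ih (c := c + 2 * j + 2) (by omega) (j + 1) hr
    obtain ⟨p, hp⟩ := exists_smul_add_euler_eq hc j (r - quad * p₁)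
    have e := congrArg lap hp
    rw [lap_smul_add_euler, map_sub, lap_quad] at e
    -- The solution `p₁` of the differentiated equation stands in for `lap p`; injectivity of `(c +
    -- 2j) + j • euler` shows that they agree.
    have hz : lap p - p₁ = 0 := by
      refine eq_zero_of_smul_add_euler_eq_zero (c := c + 2 * j) (by omega) j ?_
      rw [map_sub]
      simp only [nsmul_eq_mul] at e h₂ ⊢
      push_cast at e h₂ ⊢
      linear_combination e - h₂
    rw [sub_eq_zero] at hz
    refine ⟨p, by rw [pow_succ, Module.End.mul_apply, hz, h₁], ?_⟩
    rw [hp, hz, sub_add_cancel]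

theorem eq_zero_of_smul_add_euler_add_quad_lap_eq_zero {c : ℕ} (hc : 0 < c) (j : ℕ) {p : Poly}
    (h : c • p + j • euler p + quad * lap p = 0) : p = 0 := by
  obtain ⟨k, hk⟩ := exists_lap_pow_eq_zero p
  induction k generalizing c j p with
  | zero => simpa using hk
  | succ k ih =>
    rw [pow_succ, Module.End.mul_apply] at hk
    have e := congrArg lap h
    rw [map_add, lap_smul_add_euler, lap_quad, map_zero] at e
    have hz : lap p = 0 := by
      refine ih (c := c + 2 * j + 2) (by omega) (j + 1) ?_ hk
      simp only [nsmul_eq_mul] at e ⊢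
      push_cast at e ⊢
      linear_combination e
    rw [hz, mul_zero, add_zero] at h
    exact eq_zero_of_smul_add_euler_eq_zero hc j h

theorem eq_zero_of_lap_quad_mul_eq_zero {p : Poly} (h : lap (quad * p) = 0) : p = 0 := by
  refine eq_zero_of_smul_add_euler_add_quad_lap_eq_zero two_pos 1 ?_
  rw [lap_quad] at h
  rw [one_smul, two_smul, ← h]
  ring

theorem exists_lap_quad_mul_eq {k : ℕ} {r : Poly} (hr : (lap ^ k) r = 0) :
    ∃ p, (lap ^ k) p = 0 ∧ lap (quad * p) = r := by
  obtain ⟨p, hp, e⟩ := exists_smul_add_euler_add_quad_lap_eq k two_pos 1 hr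
  refine ⟨p, hp, ?_⟩
  rw [lap_quad, ← e, one_smul, two_smul]
  ring

/-- One step of the Fischer decomposition. The quotient `p'` is killed by a smaller power of `lap`,
which drives every later induction about the projection. -/
theorem exists_harmonic_add_quad_mul {k : ℕ} {p : Poly} (hp : (lap ^ (k + 1)) p = 0) :
    ∃ h p', lap h = 0 ∧ (lap ^ k) p' = 0 ∧ p = h + quad * p' := by
  rw [pow_succ, Module.End.mul_apply] at hp
  obtain ⟨p', hp', e⟩ := exists_lap_quad_mul_eq hp
  exact ⟨p - quad * p', p', by rw [map_sub, e, sub_self], hp', (sub_add_cancel _ _).symm⟩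

theorem lap_pow_weight (k : ℕ) (p : Poly) : (lap ^ k) (weight p) = weight ((lap ^ k) p) := by
  induction k generalizing p with
  | zero => rfl
  | succ k ih => rw [pow_succ, Module.End.mul_apply, Module.End.mul_apply, lap_weight, ih]

theorem lap_pow_lap {k : ℕ} {p : Poly} (hp : (lap ^ k) p = 0) : (lap ^ k) (lap p) = 0 := by
  rw [← Module.End.mul_apply, ← pow_succ, pow_succ', Module.End.mul_apply, hp, map_zero]

/-- The symbol of the right multiplication by `2 (K₀ - R̂)`, with `h = ε / 2` and `c = 2 R̂`. -/
def shiftOp (h c : ℂ) : Module.End ℂ Poly :=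
  LinearMap.mulLeft ℂ quad - (h • weight + h ^ 2 • lap + c • LinearMap.id)

theorem shiftOp_apply (h c : ℂ) (p : Poly) :
    shiftOp h c p = quad * p - (h • weight p + h ^ 2 • lap p + c • p) := rfl

theorem exists_sub_mem_range_shiftOp (h c : ℂ) (p : Poly) :
    ∃ u, lap u = 0 ∧ p - u ∈ LinearMap.range (shiftOp h c) := by
  obtain ⟨k, hk⟩ := exists_lap_pow_eq_zero p
  induction k generalizing p with
  | zero =>
    obtain rfl : p = 0 := by simpa using hk
    exact ⟨0, by simp, by simp⟩
  | succ k ih =>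
    obtain ⟨u, p', hu, hp', rfl⟩ := exists_harmonic_add_quad_mul hk
    -- Modulo the range of `shiftOp`, `quad * p'` equals this polynomial, which `lap ^ k` already
    -- kills.
    obtain ⟨v, hv, hv'⟩ := ih (h • weight p' + h ^ 2 • lap p' + c • p') (by
      simp only [map_add, map_smul, lap_pow_weight, lap_pow_lap hp', hp', map_zero, smul_zero,
        add_zero])
    refine ⟨u + v, by rw [map_add, hu, hv, add_zero], ?_⟩
    have := Submodule.add_mem _ (LinearMap.mem_range_self (shiftOp h c) p') hv'
    rw [shiftOp_apply] at this
    convert this using 1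
    abel

/-- If `lap ^ (k + 1)` kills `p`, the hypothesis writes `lap (quad * p)` as something killed by `lap
^ k`. Since `lap ∘ quad` is injective and already surjective on the kernel of `lap ^ k`, `p` lies in
that kernel; descend to `k = 0`. -/
theorem eq_zero_of_lap_shiftOp_eq_zero (h c : ℂ) {p : Poly} (hp : lap (shiftOp h c p) = 0) :
    p = 0 := by
  obtain ⟨k, hk⟩ := exists_lap_pow_eq_zero p
  induction k with
  | zero => simpa using hk
  | succ k ih =>
    refine ih ?_
    rw [pow_succ, Module.End.mul_apply] at hk
    rw [shiftOp_apply, map_sub, sub_eq_zero] at hp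
    obtain ⟨p', hp', e⟩ := exists_lap_quad_mul_eq (k := k)
      (r := lap (h • weight p + h ^ 2 • lap p + c • p)) (by
        simp only [map_add, map_smul, lap_weight, lap_pow_weight, lap_pow_lap hk, hk, map_zero,
          smul_zero, add_zero])
    have : p - p' = 0 := eq_zero_of_lap_quad_mul_eq_zero (by
      rw [mul_sub, map_sub, hp, e, sub_self])
    rw [sub_eq_zero.mp this, hp']

/-! ### Symbols -/

/-- The sign of the commutator of a generator with its conjugate. -/
def Gen.sign : Gen → ℂ
  | .ap => -1
  | .am => 1
  | .bp => -1
  | .bm => 1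

/-- The symbol of the left multiplication by a generator, with `h = ε / 2`. -/
def leftOp (h : ℂ) (g : Gen) : Module.End ℂ Poly :=
  LinearMap.mulLeft ℂ (X g) + (h * g.sign) • (pderiv g.flip).toLinearMap

/-- The symbol of the right multiplication by a generator, with `h = ε / 2`. -/
def rightOp (h : ℂ) (g : Gen) : Module.End ℂ Poly :=
  LinearMap.mulLeft ℂ (X g) - (h * g.sign) • (pderiv g.flip).toLinearMap

theorem leftOp_apply (h : ℂ) (g : Gen) (p : Poly) :
    leftOp h g p = X g * p + C (h * g.sign) * pderiv g.flip p := by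
  rw [← smul_eq_C_mul]; rfl

theorem rightOp_apply (h : ℂ) (g : Gen) (p : Poly) :
    rightOp h g p = X g * p - C (h * g.sign) * pderiv g.flip p := by
  rw [← smul_eq_C_mul]; rfl

theorem leftOp_rightOp (h : ℂ) (g g' : Gen) (p : Poly) :
    leftOp h g (rightOp h g' p) = rightOp h g' (leftOp h g p) := by
  simp only [leftOp_apply, rightOp_apply, map_add, map_sub, Derivation.leibniz, pderiv_C,
    smul_eq_mul, pderiv_pderiv_comm g.flip g'.flip]
  cases g <;> cases g' <;> simp [Gen.flip, Gen.sign] <;> ring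

theorem leftOp_leftOp_of_ne_flip (h : ℂ) {g g' : Gen} (hg : g' ≠ g.flip) (p : Poly) :
    leftOp h g (leftOp h g' p) = leftOp h g' (leftOp h g p) := by
  have h1 : g ≠ g'.flip := fun e => hg (by rw [e, Gen.flip_flip])
  simp only [leftOp_apply, map_add, Derivation.leibniz, pderiv_C, pderiv_X_of_ne hg,
    pderiv_X_of_ne h1, smul_eq_mul, pderiv_pderiv_comm g.flip g'.flip]
  ring

theorem leftOp_rel (ε : ℝ) ⦃x y : FreeAlgebra ℂ Gen⦄ (h : Rel ε x y) :
    FreeAlgebra.lift ℂ (leftOp (ε / 2)) x = FreeAlgebra.lift ℂ (leftOp (ε / 2)) y := by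
  have hε : (C (ε : ℂ) : Poly) = C ((ε : ℂ) / 2) + C ((ε : ℂ) / 2) := by rw [← C_add, add_halves]
  refine LinearMap.ext fun p => ?_
  cases h <;>
  simp only [letter, map_sub, map_mul, FreeAlgebra.lift_ι_apply, AlgHom.commutes,
    LinearMap.sub_apply, Module.End.mul_apply, Module.algebraMap_end_apply]
  case aa | bb =>
    simp [leftOp_apply, Gen.flip, Gen.sign, smul_eq_C_mul, hε, pderiv_am_ap, pderiv_bm_bp]
    ring
  all_goals exact leftOp_leftOp_of_ne_flip _ (by simp [Gen.flip]) _

/-- The representation of `𝒲(ε)` on symbols by left multiplication. -/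
def leftRep (ε : ℝ) : W ε →ₐ[ℂ] Module.End ℂ Poly :=
  RingQuot.liftAlgHom ℂ ⟨FreeAlgebra.lift ℂ (leftOp (ε / 2)), leftOp_rel ε⟩

@[simp]
theorem leftRep_gen (ε : ℝ) (g : Gen) : leftRep ε (gen ε g) = leftOp (ε / 2) g := by
  rw [leftRep, gen, RingQuot.liftAlgHom_mkAlgHom_apply, letter]
  exact FreeAlgebra.lift_ι_apply _ _

theorem W.induction {ε : ℝ} {motive : W ε → Prop}
    (algebraMap : ∀ c, motive (algebraMap ℂ (W ε) c)) (gen : ∀ g, motive (gen ε g))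
    (mul : ∀ v w, motive v → motive w → motive (v * w))
    (add : ∀ v w, motive v → motive w → motive (v + w)) (w : W ε) : motive w := by
  obtain ⟨x, rfl⟩ := RingQuot.mkAlgHom_surjective ℂ (Rel ε) w
  induction x using FreeAlgebra.induction with
  | grade0 c => rw [AlgHom.commutes]; exact algebraMap c
  | grade1 g => exact gen g
  | mul v w hv hw => rw [map_mul]; exact mul _ _ hv hw
  | add v w hv hw => rw [map_add]; exact add _ _ hv hw

/-- Because `rightOp` commutes with the whole left action and sends `1` to `X g`, it represents
right multiplication on symbols. -/
theorem leftRep_rightOp (ε : ℝ) (w : W ε) (g : Gen) (p : Poly) :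
    leftRep ε w (rightOp (ε / 2) g p) = rightOp (ε / 2) g (leftRep ε w p) := by
  induction w using W.induction generalizing p with
  | algebraMap c => simp [Module.algebraMap_end_apply]
  | gen g' => rw [leftRep_gen, leftOp_rightOp]
  | mul v w hv hw => rw [map_mul, Module.End.mul_apply, Module.End.mul_apply, hw, hv]
  | add v w hv hw => rw [map_add, LinearMap.add_apply, LinearMap.add_apply, map_add, hv, hw]

/-- The Weyl symbol of an element of `𝒲(ε)`. -/
def symbol (ε : ℝ) : W ε →ₗ[ℂ] Poly := LinearMap.applyₗ (1 : Poly) ∘ₗ (leftRep ε).toLinearMap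

theorem symbol_apply (ε : ℝ) (w : W ε) : symbol ε w = leftRep ε w 1 := rfl

@[simp]
theorem symbol_one (ε : ℝ) : symbol ε 1 = 1 := by rw [symbol_apply, map_one (leftRep ε)]; rfl

theorem symbol_mul (ε : ℝ) (v w : W ε) : symbol ε (v * w) = leftRep ε v (symbol ε w) := by
  rw [symbol_apply, map_mul]; rfl

@[simp]
theorem symbol_gen (ε : ℝ) (g : Gen) : symbol ε (gen ε g) = X g := by
  rw [symbol_apply, leftRep_gen, leftOp_apply, pderiv_one, mul_zero, add_zero, mul_one]

theorem symbol_algebraMap (ε : ℝ) (c : ℂ) : symbol ε (algebraMap ℂ (W ε) c) = C c := by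
  rw [symbol_apply, AlgHom.commutes, Module.algebraMap_end_apply, smul_eq_C_mul, mul_one]

theorem symbol_gen_mul (ε : ℝ) (g : Gen) (w : W ε) :
    symbol ε (gen ε g * w) = leftOp (ε / 2) g (symbol ε w) := by
  rw [symbol_mul, leftRep_gen]

theorem symbol_mul_gen (ε : ℝ) (w : W ε) (g : Gen) :
    symbol ε (w * gen ε g) = rightOp (ε / 2) g (symbol ε w) := by
  have h : (X g : Poly) = rightOp (ε / 2) g 1 := by
    rw [rightOp_apply, pderiv_one, mul_zero, sub_zero, mul_one]
  rw [symbol_mul, symbol_gen, h, leftRep_rightOp]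
  rfl

theorem symbol_toW {ε : ℝ} {t : List Gen →₀ ℂ} (ht : t ∈ Sym) :
    symbol ε (toW ε t) = comm t := by
  refine sym_induction (motive := fun t => symbol ε (toW ε t) = comm t) (by simp) ?_ ht
  intro t ht ih
  -- The first-order Moyal corrections of `g` and `g.flip` have opposite signs; this symmetry makes
  -- them cancel in pairs.
  have hw : ∀ g, wordDeriv g.flip (behead g t) = wordDeriv g (behead g.flip t) := fun g => by
    ext l
    simp only [wordDeriv_apply, behead_apply]
    rw [ht _ _ (List.Perm.swap g g.flip l)]
  have ha := hw .ap
  have hb := hw .bp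
  change symbol ε (ev (gen ε) t) = _
  rw [ev_eq, comm, ev_eq X t]
  simp only [map_add, symbol_gen_mul, symbol_algebraMap]
  have ih' : ∀ g, symbol ε (ev (gen ε) (behead g t)) = comm (behead g t) := ih
  simp only [ih', leftOp_apply, Gen.flip, Gen.sign, pderiv_comm (behead_mem_sym ht _)] at ha hb ⊢
  rw [ha, hb]
  simp [MvPolynomial.algebraMap_eq]
  ring

/-! ### Normal ordering -/

theorem gen_am_mul_ap (ε : ℝ) :
    gen ε .am * gen ε .ap = gen ε .ap * gen ε .am + algebraMap ℂ (W ε) ε := by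
  have := RingQuot.mkAlgHom_rel ℂ (Rel.aa (ε := ε))
  rw [map_sub, map_mul, map_mul, AlgHom.commutes, sub_eq_iff_eq_add'] at this
  exact this

theorem gen_bm_mul_bp (ε : ℝ) :
    gen ε .bm * gen ε .bp = gen ε .bp * gen ε .bm + algebraMap ℂ (W ε) ε := by
  have := RingQuot.mkAlgHom_rel ℂ (Rel.bb (ε := ε))
  rw [map_sub, map_mul, map_mul, AlgHom.commutes, sub_eq_iff_eq_add'] at this
  exact this

theorem commute_ap_bp (ε : ℝ) : Commute (gen ε .ap) (gen ε .bp) := by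
  have := RingQuot.mkAlgHom_rel ℂ (Rel.apbp (ε := ε))
  rwa [map_mul, map_mul] at this

theorem commute_ap_bm (ε : ℝ) : Commute (gen ε .ap) (gen ε .bm) := by
  have := RingQuot.mkAlgHom_rel ℂ (Rel.apbm (ε := ε))
  rwa [map_mul, map_mul] at this

theorem commute_am_bp (ε : ℝ) : Commute (gen ε .am) (gen ε .bp) := by
  have := RingQuot.mkAlgHom_rel ℂ (Rel.ambp (ε := ε))
  rwa [map_mul, map_mul] at this

theorem commute_am_bm (ε : ℝ) : Commute (gen ε .am) (gen ε .bm) := by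
  have := RingQuot.mkAlgHom_rel ℂ (Rel.ambm (ε := ε))
  rwa [map_mul, map_mul] at this

/-- Normally ordered quantization. -/
def normal (ε : ℝ) : Poly →ₗ[ℂ] W ε :=
  (basisMonomials Gen ℂ).constr ℂ fun s =>
    gen ε .ap ^ s .ap * gen ε .bp ^ s .bp * (gen ε .am ^ s .am * gen ε .bm ^ s .bm)

theorem normal_monomial (ε : ℝ) (s : Gen →₀ ℕ) :
    normal ε (monomial s 1) =
      gen ε .ap ^ s .ap * gen ε .bp ^ s .bp * (gen ε .am ^ s .am * gen ε .bm ^ s .bm) := by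
  exact Module.Basis.constr_basis (basisMonomials Gen ℂ) ℂ _ s

theorem poly_linearMap_ext {V : Type*} [AddCommGroup V] [Module ℂ V] {S T : Poly →ₗ[ℂ] V}
    (h : ∀ s, S (monomial s 1) = T (monomial s 1)) : S = T :=
  (basisMonomials Gen ℂ).ext fun s => by rw [coe_basisMonomials]; exact h s

theorem X_mul_monomial_one (g : Gen) (s : Gen →₀ ℕ) :
    (X g * monomial s 1 : Poly) = monomial (s + Finsupp.single g 1) 1 := by
  rw [X, monomial_mul, one_mul, add_comm]

theorem normal_one (ε : ℝ) : normal ε 1 = 1 := by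
  have := normal_monomial ε 0
  simpa using this

theorem normal_ap_mul (ε : ℝ) (p : Poly) :
    normal ε (X .ap * p) = gen ε .ap * normal ε p := by
  refine LinearMap.congr_fun (f := normal ε ∘ₗ LinearMap.mulLeft ℂ (X .ap))
    (g := LinearMap.mulLeft ℂ (gen ε .ap) ∘ₗ normal ε) (poly_linearMap_ext fun s => ?_) p
  simp [X_mul_monomial_one, normal_monomial, pow_succ', mul_assoc]

theorem normal_bp_mul (ε : ℝ) (p : Poly) :
    normal ε (X .bp * p) = gen ε .bp * normal ε p := by
  refine LinearMap.congr_fun (f := normal ε ∘ₗ LinearMap.mulLeft ℂ (X .bp))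
    (g := LinearMap.mulLeft ℂ (gen ε .bp) ∘ₗ normal ε) (poly_linearMap_ext fun s => ?_) p
  have := ((commute_ap_bp ε).symm.pow_right (s .ap)).eq
  simp only [LinearMap.comp_apply, LinearMap.mulLeft_apply, X_mul_monomial_one, normal_monomial,
    ← mul_assoc, this]
  simp [pow_succ', mul_assoc]

theorem normal_am_mul (ε : ℝ) (p : Poly) :
    normal ε (X .am * p) = normal ε p * gen ε .am := by
  refine LinearMap.congr_fun (f := normal ε ∘ₗ LinearMap.mulLeft ℂ (X .am))
    (g := LinearMap.mulRight ℂ (gen ε .am) ∘ₗ normal ε) (poly_linearMap_ext fun s => ?_) p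
  have := ((commute_am_bm ε).symm.pow_left (s .bm)).eq
  simp only [LinearMap.comp_apply, LinearMap.mulLeft_apply, LinearMap.mulRight_apply,
    X_mul_monomial_one, normal_monomial, mul_assoc, this]
  simp [pow_succ, mul_assoc]

theorem normal_bm_mul (ε : ℝ) (p : Poly) :
    normal ε (X .bm * p) = normal ε p * gen ε .bm := by
  refine LinearMap.congr_fun (f := normal ε ∘ₗ LinearMap.mulLeft ℂ (X .bm))
    (g := LinearMap.mulRight ℂ (gen ε .bm) ∘ₗ normal ε) (poly_linearMap_ext fun s => ?_) p
  simp [X_mul_monomial_one, normal_monomial, pow_succ, mul_assoc]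

theorem am_mul_normal (ε : ℝ) (p : Poly) :
    gen ε .am * normal ε p = normal ε (X .am * p) + (ε : ℂ) • normal ε (pderiv .ap p) := by
  induction p using MvPolynomial.induction_on with
  | C c =>
    have := normal_am_mul ε 1
    rw [mul_one, normal_one, one_mul] at this
    simp [C_eq_smul_one, normal_one, this]
  | add p q hp hq => simp only [map_add, mul_add, hp, hq, smul_add]; abel
  | mul_X p g ih =>
    rw [mul_comm p, mul_left_comm]
    rw [normal_am_mul] at ih
    cases g
    · rw [normal_ap_mul, normal_ap_mul, ← mul_assoc, gen_am_mul_ap, add_mul, mul_assoc, ih,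
        normal_am_mul, mul_add, ← Algebra.smul_def]
      simp [normal_ap_mul, add_assoc, -Complex.coe_smul]
    · rw [normal_am_mul, ← mul_assoc, ih, normal_am_mul, normal_am_mul]
      simp [add_mul, normal_am_mul]
    · rw [normal_bp_mul, normal_bp_mul, ← mul_assoc, (commute_am_bp ε).eq, mul_assoc, ih,
        normal_am_mul]
      simp [mul_add, normal_bp_mul]
    · rw [normal_bm_mul, normal_bm_mul, ← mul_assoc, ih, normal_am_mul]
      simp [add_mul, normal_bm_mul]

theorem bm_mul_normal (ε : ℝ) (p : Poly) :
    gen ε .bm * normal ε p = normal ε (X .bm * p) + (ε : ℂ) • normal ε (pderiv .bp p) := by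
  induction p using MvPolynomial.induction_on with
  | C c =>
    have := normal_bm_mul ε 1
    rw [mul_one, normal_one, one_mul] at this
    simp [C_eq_smul_one, normal_one, this]
  | add p q hp hq => simp only [map_add, mul_add, hp, hq, smul_add]; abel
  | mul_X p g ih =>
    rw [mul_comm p, mul_left_comm]
    rw [normal_bm_mul] at ih
    cases g
    · rw [normal_ap_mul, normal_ap_mul, ← mul_assoc, ← (commute_ap_bm ε).eq, mul_assoc, ih,
        normal_bm_mul]
      simp [mul_add, normal_ap_mul]
    · rw [normal_am_mul, normal_am_mul, ← mul_assoc, ih, normal_bm_mul]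
      simp [add_mul, normal_am_mul]
    · rw [normal_bp_mul, normal_bp_mul, ← mul_assoc, gen_bm_mul_bp, add_mul, mul_assoc, ih,
        normal_bm_mul, mul_add, ← Algebra.smul_def]
      simp [normal_bp_mul, add_assoc, -Complex.coe_smul]
    · rw [normal_bm_mul, ← mul_assoc, ih, normal_bm_mul, normal_bm_mul]
      simp [add_mul, normal_bm_mul]

/-! ### Bijectivity of the Weyl symbol, by comparison with normal ordering -/

theorem normal_surjective (ε : ℝ) : Function.Surjective (normal ε) := by
  have key : ∀ w : W ε, ∀ p, ∃ r, normal ε r = w * normal ε p := fun w => by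
    induction w using W.induction with
    | algebraMap c => exact fun p => ⟨c • p, by rw [map_smul, Algebra.smul_def]⟩
    | gen g =>
      intro p
      cases g
      · exact ⟨_, normal_ap_mul ε p⟩
      · exact ⟨X .am * p + (ε : ℂ) • pderiv .ap p, by rw [am_mul_normal, map_add, map_smul]⟩
      · exact ⟨_, normal_bp_mul ε p⟩
      · exact ⟨X .bm * p + (ε : ℂ) • pderiv .bp p, by rw [bm_mul_normal, map_add, map_smul]⟩
    | mul v w hv hw =>
      intro p
      obtain ⟨r, hr⟩ := hw p
      obtain ⟨r', hr'⟩ := hv r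
      exact ⟨r', by rw [hr', hr, mul_assoc]⟩
    | add v w hv hw =>
      intro p
      obtain ⟨r, hr⟩ := hw p
      obtain ⟨r', hr'⟩ := hv p
      exact ⟨r' + r, by rw [map_add, hr', hr, add_mul]⟩
  intro w
  obtain ⟨r, hr⟩ := key w 1
  exact ⟨r, by rw [hr, normal_one, mul_one]⟩

theorem symbol_normal_X_mul (ε : ℝ) (g : Gen) (p : Poly) :
    symbol ε (normal ε (X g * p)) =
      X g * symbol ε (normal ε p) - C ((ε : ℂ) / 2) * pderiv g.flip (symbol ε (normal ε p)) := by
  cases g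
  · simp [normal_ap_mul, symbol_gen_mul, leftOp_apply, Gen.sign, sub_eq_add_neg]
  · simp [normal_am_mul, symbol_mul_gen, rightOp_apply, Gen.sign]
  · simp [normal_bp_mul, symbol_gen_mul, leftOp_apply, Gen.sign, sub_eq_add_neg]
  · simp [normal_bm_mul, symbol_mul_gen, rightOp_apply, Gen.sign]

theorem pderiv_symbol_normal (ε : ℝ) (h : Gen) (p : Poly) :
    pderiv h (symbol ε (normal ε p)) = symbol ε (normal ε (pderiv h p)) := by
  classical
  induction p using MvPolynomial.induction_on with
  | C c => simp [C_eq_smul_one, normal_one]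
  | add p q hp hq => simp only [map_add, hp, hq]
  | mul_X p g ih =>
    rw [mul_comm p, symbol_normal_X_mul]
    simp only [Derivation.leibniz, map_add, map_sub, smul_eq_mul, pderiv_C, ih,
      symbol_normal_X_mul, pderiv_pderiv_comm h g.flip, pderiv_X, Pi.single_apply]
    split_ifs
    · simp; ring
    · simp

/-- The passage from normal to Weyl symbols commutes with all partial derivatives and fixes
constants, so a kernel element has vanishing derivatives by induction, hence is a constant, hence
zero. -/
theorem symbol_normal_injective (ε : ℝ) (p : Poly) (h : symbol ε (normal ε p) = 0) : p = 0 := by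
  induction p using pderiv_induction with
  | zero => rfl
  | step p ih =>
    have e := eq_C_of_pderiv_eq_zero fun g =>
      ih g (by rw [← pderiv_symbol_normal, h, map_zero])
    rw [e, C_eq_smul_one, map_smul, map_smul, normal_one, symbol_one, ← C_eq_smul_one] at h
    rw [e, h]

theorem symbol_injective (ε : ℝ) : Function.Injective (symbol ε) := by
  rw [injective_iff_map_eq_zero]
  intro w hw
  obtain ⟨p, rfl⟩ := normal_surjective ε w
  rw [symbol_normal_injective ε p hw, map_zero]

/-- Weyl quantization, the inverse of `symbol`. -/
def weyl (ε : ℝ) : Poly →ₗ[ℂ] W ε := toW ε ∘ₗ symm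

@[simp]
theorem symbol_weyl (ε : ℝ) (p : Poly) : symbol ε (weyl ε p) = p := by
  rw [weyl, LinearMap.comp_apply, symbol_toW (symm_mem_sym p), comm_symm]

@[simp]
theorem weyl_symbol (ε : ℝ) (w : W ε) : weyl ε (symbol ε w) = w :=
  symbol_injective ε (symbol_weyl ε _)

/-! ### The projection `ρ` on symbols -/

/-- The summand `ε` in `K0` is exactly what symmetrising `a₊ a₋ + b₊ b₋` produces, so the symbol of
`K0` is `quad / 2` with no constant term. -/
theorem symbol_mul_K0 (ε : ℝ) (w : W ε) :
    symbol ε (w * K0 ε) = (1 / 2 : ℂ) • (quad * symbol ε w -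
      (((ε : ℂ) / 2) • weight (symbol ε w) + ((ε : ℂ) / 2) ^ 2 • lap (symbol ε w))) := by
  have hε : (C (ε : ℂ) : Poly) = C ((ε : ℂ) / 2) + C ((ε : ℂ) / 2) := by rw [← C_add, add_halves]
  simp only [K0, mul_smul_comm, mul_add, ← mul_assoc, map_smul, map_add, symbol_mul_gen,
    ← Algebra.commutes, ← Algebra.smul_def]
  congr 1
  simp [rightOp_apply, smul_eq_C_mul, hε, Gen.sign, Gen.flip, lap_apply, weight_apply, quad]
  ring

theorem symbol_K0_mul (ε : ℝ) (w : W ε) :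
    symbol ε (K0 ε * w) = (1 / 2 : ℂ) • (quad * symbol ε w +
      (((ε : ℂ) / 2) • weight (symbol ε w) - ((ε : ℂ) / 2) ^ 2 • lap (symbol ε w))) := by
  have hε : (C (ε : ℂ) : Poly) = C ((ε : ℂ) / 2) + C ((ε : ℂ) / 2) := by rw [← C_add, add_halves]
  simp only [K0, smul_mul_assoc, add_mul, mul_assoc, map_smul, map_add, symbol_gen_mul,
    ← Algebra.smul_def]
  congr 1
  simp [leftOp_apply, smul_eq_C_mul, hε, Gen.sign, Gen.flip, lap_apply, weight_apply, quad,
    pderiv_am_ap, pderiv_bm_bp]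
  ring

theorem symbol_ad_K0 (ε : ℝ) (w : W ε) :
    symbol ε (Ad ε (K0 ε) w) = ((ε : ℂ) / 2) • weight (symbol ε w) := by
  rw [Ad, LinearMap.sub_apply, LinearMap.mulLeft_apply, LinearMap.mulRight_apply, map_sub,
    symbol_mul_K0, symbol_K0_mul]
  module

theorem symbol_mul_K0_sub (R ε : ℝ) (w : W ε) :
    symbol ε (w * (K0 ε - algebraMap ℂ (W ε) (Rhat R ε))) =
      (1 / 2 : ℂ) • shiftOp (ε / 2) (2 * Rhat R ε) (symbol ε w) := by
  rw [mul_sub, ← Algebra.commutes, ← Algebra.smul_def, map_sub, map_smul, symbol_mul_K0,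
    shiftOp_apply]
  module

theorem mem_Psi_iff {ε : ℝ} {w : W ε} : w ∈ Psi ε ↔ lap (symbol ε w) = 0 := by
  constructor
  · rintro ⟨t, ht, rfl⟩
    rw [symbol_toW ht.1]
    exact (mem_symTraceless_iff ht.1).mp ht
  · intro h
    refine ⟨symm (symbol ε w), (mem_symTraceless_iff (symm_mem_sym _)).mpr ?_, weyl_symbol ε w⟩
    rwa [comm_symm]

theorem mem_kerRho_iff {R ε : ℝ} {w : W ε} :
    w ∈ kerRho R ε ↔ symbol ε w ∈ LinearMap.range (shiftOp (ε / 2) (2 * Rhat R ε)) := by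
  constructor
  · rintro ⟨v, rfl⟩
    rw [LinearMap.mulRight_apply, symbol_mul_K0_sub]
    exact Submodule.smul_mem _ _ (LinearMap.mem_range_self _ _)
  · rintro ⟨p, hp⟩
    refine ⟨weyl ε ((2 : ℂ) • p), symbol_injective ε ?_⟩
    rw [LinearMap.mulRight_apply, symbol_mul_K0_sub, symbol_weyl, map_smul, smul_smul, ← hp]
    norm_num

/-- Excludes the default branch in the definition of `rho`, for all real `R` and `ε`, including `ε =
0`. -/
theorem isCompl_Psi_kerRho (R ε : ℝ) : IsCompl (Psi ε) (kerRho R ε) := by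
  constructor
  · refine Submodule.disjoint_def.mpr fun w hw hw' => symbol_injective ε ?_
    obtain ⟨p, hp⟩ := mem_kerRho_iff.mp hw'
    have := eq_zero_of_lap_shiftOp_eq_zero _ _ (hp ▸ mem_Psi_iff.mp hw)
    rw [← hp, this, map_zero, map_zero]
  · refine Submodule.codisjoint_iff_exists_add_eq.mpr fun w => ?_
    obtain ⟨u, hu, hu'⟩ := exists_sub_mem_range_shiftOp (ε / 2) (2 * Rhat R ε) (symbol ε w)
    refine ⟨weyl ε u, w - weyl ε u, ?_, ?_, by abel⟩
    · rwa [mem_Psi_iff, symbol_weyl]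
    · rwa [mem_kerRho_iff, map_sub, symbol_weyl]

theorem rho_eq_projection (R ε : ℝ) :
    rho R ε = (Psi ε).projection (kerRho R ε) (isCompl_Psi_kerRho R ε) :=
  dif_pos _

/-- The projection `ρ` on symbols. -/
def rhoSymbol (R ε : ℝ) : Module.End ℂ Poly := symbol ε ∘ₗ rho R ε ∘ₗ weyl ε

theorem symbol_rho (R ε : ℝ) (w : W ε) : symbol ε (rho R ε w) = rhoSymbol R ε (symbol ε w) := by
  simp [rhoSymbol]

theorem lap_rhoSymbol (R ε : ℝ) (p : Poly) : lap (rhoSymbol R ε p) = 0 := by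
  rw [rhoSymbol, LinearMap.comp_apply, ← mem_Psi_iff, LinearMap.comp_apply, rho_eq_projection]
  exact Submodule.projection_apply_mem _ _

theorem rhoSymbol_of_lap_eq_zero (R ε : ℝ) {p : Poly} (hp : lap p = 0) :
    rhoSymbol R ε p = p := by
  rw [rhoSymbol, LinearMap.comp_apply, LinearMap.comp_apply, rho_eq_projection,
    Submodule.projection_apply_of_mem_left, symbol_weyl]
  rwa [mem_Psi_iff, symbol_weyl]

theorem rhoSymbol_shiftOp (R ε : ℝ) (p : Poly) :
    rhoSymbol R ε (shiftOp (ε / 2) (2 * Rhat R ε) p) = 0 := by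
  rw [rhoSymbol, LinearMap.comp_apply, LinearMap.comp_apply, rho_eq_projection,
    (Submodule.projection_apply_eq_zero_iff _).mpr, map_zero]
  rw [mem_kerRho_iff, symbol_weyl]
  exact LinearMap.mem_range_self _ _

/-- The reduction rule of the fuzzy sphere: to leading order `quad` becomes the number `2R̂`. With
the Fischer decomposition it determines `rhoSymbol` recursively. -/
theorem rhoSymbol_quad_mul (R ε : ℝ) (p : Poly) :
    rhoSymbol R ε (quad * p) = ((ε : ℂ) / 2) • rhoSymbol R ε (weight p) +
      ((ε : ℂ) / 2) ^ 2 • rhoSymbol R ε (lap p) + (2 * Rhat R ε : ℂ) • rhoSymbol R ε p := by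
  have := rhoSymbol_shiftOp R ε p
  rw [shiftOp_apply, map_sub, sub_eq_zero] at this
  rw [this, map_add, map_add, map_smul, map_smul, map_smul]

theorem sub_rhoSymbol_mem_range (R ε : ℝ) (p : Poly) :
    p - rhoSymbol R ε p ∈ LinearMap.range (shiftOp (ε / 2) (2 * Rhat R ε)) := by
  have := Submodule.sub_projection_mem (isCompl_Psi_kerRho R ε) (weyl ε p)
  rw [← rho_eq_projection, mem_kerRho_iff, map_sub, symbol_weyl] at this
  exact this

theorem shiftOp_weight (h c : ℂ) (p : Poly) :
    shiftOp h c (weight p) = weight (shiftOp h c p) := by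
  simp only [shiftOp_apply, map_sub, map_add, map_smul, weight_quad_mul, lap_weight]

/-- `weight` preserves both harmonic polynomials and the range of `shiftOp`, so applied to `p -
rhoSymbol R ε p` it gives an element of their trivial intersection. -/
theorem weight_rhoSymbol (R ε : ℝ) {p : Poly} (hp : weight p = 0) :
    weight (rhoSymbol R ε p) = 0 := by
  obtain ⟨v, hv⟩ := sub_rhoSymbol_mem_range R ε p
  have e := congrArg weight hv
  rw [← shiftOp_weight, map_sub, hp, zero_sub] at e
  have h : lap (shiftOp (ε / 2) (2 * Rhat R ε) (weight v)) = 0 := by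
    rw [e, map_neg, lap_weight, lap_rhoSymbol, map_zero, neg_zero]
  rw [eq_zero_of_lap_shiftOp_eq_zero _ _ h, map_zero, eq_comm, neg_eq_zero] at e
  exact e

theorem mem_PsiR_iff {ε r : ℝ} {w : W ε} : w ∈ PsiR ε r ↔
    lap (symbol ε w) = 0 ∧ ((ε : ℂ) / 2) • weight (symbol ε w) = (ε * r : ℂ) • symbol ε w := by
  rw [PsiR, Submodule.mem_inf, mem_Psi_iff, Module.End.mem_eigenspace_iff,
    ← (symbol_injective ε).eq_iff, symbol_ad_K0, map_smul]
  push_cast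
  rfl

theorem mem_PsiR_zero_iff {ε : ℝ} (hε : ε ≠ 0) {w : W ε} :
    w ∈ PsiR ε 0 ↔ lap (symbol ε w) = 0 ∧ weight (symbol ε w) = 0 := by
  have : (ε : ℂ) / 2 ≠ 0 := div_ne_zero (Complex.ofReal_ne_zero.mpr hε) two_ne_zero
  rw [mem_PsiR_iff, Complex.ofReal_zero, mul_zero, zero_smul, smul_eq_zero_iff_right this]

/-! ### The basis -/

/-- Since `Jm` is quadratic, its commutator is exactly `ε` times a first-order operator. Hence the
power of `ε` in `P` cancels and the symbol of `P` does not depend on `ε`. -/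
theorem symbol_ad_Jm (ε : ℝ) (w : W ε) :
    symbol ε (Ad ε (Jm ε) w) = (ε : ℂ) • rotate (symbol ε w) := by
  have hε : (C (ε : ℂ) : Poly) = C ((ε : ℂ) / 2) + C ((ε : ℂ) / 2) := by rw [← C_add, add_halves]
  rw [Ad, LinearMap.sub_apply, LinearMap.mulLeft_apply, LinearMap.mulRight_apply, map_sub, Jm,
    mul_assoc (gen ε .am) _ w, ← mul_assoc w, symbol_gen_mul, symbol_gen_mul, symbol_mul_gen, symbol_mul_gen,
    smul_eq_C_mul, hε]
  simp [leftOp_apply, rightOp_apply, rotate_apply, Gen.sign, Gen.flip, pderiv_bm_ap]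
  ring

theorem symbol_ad_Jm_pow (ε : ℝ) (k : ℕ) (w : W ε) :
    symbol ε ((Ad ε (Jm ε) ^ k) w) = (ε : ℂ) ^ k • (rotate ^ k) (symbol ε w) := by
  induction k generalizing w with
  | zero => simp
  | succ k ih =>
    rw [pow_succ, Module.End.mul_apply, ih, symbol_ad_Jm, map_smul, smul_smul, pow_succ,
      pow_succ rotate, Module.End.mul_apply]

theorem symbol_ap_pow_mul_bm_pow (ε : ℝ) (a b : ℕ) :
    symbol ε (gen ε .ap ^ a * gen ε .bm ^ b) = X .ap ^ a * X .bm ^ b := by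
  induction a with
  | zero =>
    rw [pow_zero, one_mul, pow_zero, one_mul]
    induction b with
    | zero => simp
    | succ b ih =>
      rw [pow_succ', symbol_gen_mul, ih, leftOp_apply]
      simp [Gen.flip, Derivation.leibniz_pow, pow_succ']
  | succ a ih =>
    rw [pow_succ', mul_assoc, symbol_gen_mul, ih, leftOp_apply]
    simp [Gen.flip, Derivation.leibniz_pow, pow_succ', mul_assoc]

theorem P_eq (ε : ℝ) {n r m : ℚ} {k c N a b : ℕ} (hk : n - m = k) (hc : n + m = c)
    (hN : 2 * n = N) (ha : n + r = a) (hb : n - r = b) :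
    P ε n r m = (((ε ^ k)⁻¹ * √((c.factorial : ℝ) / (N.factorial * k.factorial)) : ℝ) : ℂ) •
      (Ad ε (Jm ε) ^ k) (gen ε .ap ^ a * gen ε .bm ^ b) := by
  rw [P, hk, hc, hN, ha, hb]
  simp only [Nat.floor_natCast]

theorem symbol_P_of_eq {ε : ℝ} (hε : ε ≠ 0) {n r m : ℚ} {k c N a b : ℕ} (hk : n - m = k)
    (hc : n + m = c) (hN : 2 * n = N) (ha : n + r = a) (hb : n - r = b) :
    symbol ε (P ε n r m) = ((√((c.factorial : ℝ) / (N.factorial * k.factorial)) : ℝ) : ℂ) •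
      (rotate ^ k) (X .ap ^ a * X .bm ^ b) := by
  have : (ε : ℂ) ≠ 0 := Complex.ofReal_ne_zero.mpr hε
  rw [P_eq ε hk hc hN ha hb, map_smul, symbol_ad_Jm_pow, symbol_ap_pow_mul_bm_pow, smul_smul]
  congr 1
  push_cast
  field_simp

/-! ### The basis elements with `n = 1` that enter `d` -/

theorem P_one_one_one {ε : ℝ} (hε : ε ≠ 0) : P ε 1 1 1 = gen ε .ap * gen ε .ap := by
  refine symbol_injective ε ?_
  rw [symbol_P_of_eq hε (k := 0) (c := 2) (N := 2) (a := 2) (b := 0) (by norm_num) (by norm_num)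
    (by norm_num) (by norm_num) (by norm_num), symbol_gen_mul, symbol_gen, leftOp_apply]
  simp [Gen.flip, sq, Nat.factorial]

theorem P_one_one_zero {ε : ℝ} (hε : ε ≠ 0) :
    P ε 1 1 0 = ((2 * √(1 / 2) : ℝ) : ℂ) • (gen ε .ap * gen ε .bp) := by
  refine symbol_injective ε ?_
  rw [symbol_P_of_eq hε (k := 1) (c := 1) (N := 2) (a := 2) (b := 0) (by norm_num) (by norm_num)
    (by norm_num) (by norm_num) (by norm_num), map_smul, symbol_gen_mul, symbol_gen, leftOp_apply]
  simp [Gen.flip, sq, Nat.factorial, rotate_apply, smul_eq_C_mul, map_ofNat]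
  ring

theorem P_one_one_neg_one {ε : ℝ} (hε : ε ≠ 0) : P ε 1 1 (-1) = gen ε .bp * gen ε .bp := by
  have h : √((1 : ℝ) / (2 * 2)) = 1 / 2 := by
    rw [Real.sqrt_eq_iff_mul_self_eq] <;> norm_num
  refine symbol_injective ε ?_
  rw [symbol_P_of_eq hε (k := 2) (c := 0) (N := 2) (a := 2) (b := 0) (by norm_num) (by norm_num)
    (by norm_num) (by norm_num) (by norm_num), symbol_gen_mul, symbol_gen, leftOp_apply]
  simp only [Nat.factorial, Nat.cast_one, Nat.succ_eq_add_one, zero_add, mul_one, one_add_one_eq_two,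
    Nat.cast_ofNat, h]
  simp [Gen.flip, pow_two, rotate_apply, smul_eq_C_mul, -one_div]
  have : (C (1 / 2 : ℂ) : Poly) * 2 = 1 := by
    rw [← map_ofNat C 2, ← C_mul]; norm_num
  linear_combination (X .bp * X .bp) * this

theorem P_one_zero_one {ε : ℝ} (hε : ε ≠ 0) : P ε 1 0 1 = gen ε .ap * gen ε .bm := by
  refine symbol_injective ε ?_
  rw [symbol_P_of_eq hε (k := 0) (c := 2) (N := 2) (a := 1) (b := 1) (by norm_num) (by norm_num)
    (by norm_num) (by norm_num) (by norm_num), symbol_gen_mul, symbol_gen, leftOp_apply]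
  simp [Gen.flip, Nat.factorial]

theorem P_one_zero_zero {ε : ℝ} (hε : ε ≠ 0) :
    P ε 1 0 0 = ((√(1 / 2) : ℝ) : ℂ) • (gen ε .bp * gen ε .bm - gen ε .ap * gen ε .am) := by
  refine symbol_injective ε ?_
  rw [symbol_P_of_eq hε (k := 1) (c := 1) (N := 2) (a := 1) (b := 1) (by norm_num) (by norm_num)
    (by norm_num) (by norm_num) (by norm_num), map_smul, map_sub, symbol_gen_mul, symbol_gen_mul,
    symbol_gen, symbol_gen, leftOp_apply, leftOp_apply]
  simp [Gen.flip, Nat.factorial, rotate_apply, smul_eq_C_mul, Gen.sign]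
  ring

theorem P_one_zero_neg_one {ε : ℝ} (hε : ε ≠ 0) : P ε 1 0 (-1) = -(gen ε .bp * gen ε .am) := by
  have h : √((1 : ℝ) / (2 * 2)) = 1 / 2 := by
    rw [Real.sqrt_eq_iff_mul_self_eq] <;> norm_num
  refine symbol_injective ε ?_
  rw [symbol_P_of_eq hε (k := 2) (c := 0) (N := 2) (a := 1) (b := 1) (by norm_num) (by norm_num)
    (by norm_num) (by norm_num) (by norm_num), map_neg, symbol_gen_mul, symbol_gen, leftOp_apply]
  simp only [Nat.factorial, Nat.cast_one, Nat.succ_eq_add_one, zero_add, mul_one, one_add_one_eq_two,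
    Nat.cast_ofNat, h]
  simp [Gen.flip, pow_two, rotate_apply, smul_eq_C_mul, -one_div]
  have : (C (1 / 2 : ℂ) : Poly) * 2 = 1 := by
    rw [← map_ofNat C 2, ← C_mul]; norm_num
  linear_combination (-X .bp * X .am) * this

theorem dagger_smul (ε : ℝ) (c : ℂ) (w : W ε) :
    dagger ε (c • w) = starRingEnd ℂ c • dagger ε w := by
  rw [Algebra.smul_def, dagger_mul, dagger_algebraMap, ← Algebra.commutes, ← Algebra.smul_def]

/-! ### The exterior derivative -/

/-- The sum over `m` contracts the spin indices: the same inner sandwich appears between `a₋, b₋`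
and between `b₋, a₋`, with opposite signs. Each of the two factors has a simple symbol. -/
theorem omega_eq (R : ℝ) {ε : ℝ} (hε : ε ≠ 0) (w : W ε) :
    omega R ε 0 1 1 w =
      rho R ε (gen ε .am * (gen ε .am * w * gen ε .ap + gen ε .bm * w * gen ε .bp) * gen ε .bm -
        gen ε .bm * (gen ε .am * w * gen ε .ap + gen ε .bm * w * gen ε .bp) * gen ε .am) := by
  have hs : (√(1 / 2) : ℝ) * √(1 / 2) = 1 / 2 := Real.mul_self_sqrt (by norm_num)
  have hs' : ((2 * √(1 / 2) : ℝ) : ℂ) * ((√(1 / 2) : ℝ) : ℂ) = 1 := by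
    rw [← Complex.ofReal_mul, mul_assoc, hs]; norm_num
  have hf : ⌊2 * (1 : ℚ)⌋₊ + 1 = 3 := by norm_num
  rw [omega, hf, Finset.sum_range_succ, Finset.sum_range_succ, Finset.sum_range_one]
  have h0 : ((0 : ℕ) : ℚ) - 1 = -1 := by norm_num
  have h1 : ((1 : ℕ) : ℚ) - 1 = 0 := by norm_num
  have h2 : ((2 : ℕ) : ℚ) - 1 = 1 := by norm_num
  rw [h0, h1, h2, ← map_add, ← map_add, P_one_one_one hε, P_one_one_zero hε, P_one_one_neg_one hε,
    P_one_zero_one hε, P_one_zero_zero hε, P_one_zero_neg_one hε, dagger_smul, dagger_mul,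
    dagger_mul, dagger_mul, dagger_gen, dagger_gen, Complex.conj_ofReal, smul_mul_assoc,
    smul_mul_assoc, mul_smul_comm, smul_smul, hs', one_smul]
  congr 1
  simp only [Gen.flip]
  have hc := (commute_am_bm ε).eq
  have hc' : ∀ v, gen ε .bm * (gen ε .am * v) = gen ε .am * (gen ε .bm * v) := fun v => by
    rw [← mul_assoc, ← hc, mul_assoc]
  have hn : ∀ u v : W ε, u * -v = -(u * v) := fun u v => mul_neg u v
  simp only [mul_add, add_mul, mul_sub, mul_assoc, hn, hc']
  abel

theorem symbol_sandwich (ε : ℝ) (w : W ε) :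
    symbol ε (gen ε .am * w * gen ε .ap + gen ε .bm * w * gen ε .bp) =
      quad * symbol ε w + ((ε : ℂ) / 2) • (euler (symbol ε w) + (2 : ℂ) • symbol ε w) +
        ((ε : ℂ) / 2) ^ 2 • lap (symbol ε w) := by
  rw [map_add, mul_assoc, mul_assoc, symbol_gen_mul, symbol_gen_mul, symbol_mul_gen,
    symbol_mul_gen]
  simp [leftOp_apply, rightOp_apply, Gen.sign, Gen.flip, smul_eq_C_mul, quad, euler_apply,
    lap_apply, map_ofNat]
  ring

theorem symbol_exchange (ε : ℝ) (w : W ε) :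
    symbol ε (gen ε .am * w * gen ε .bm - gen ε .bm * w * gen ε .am) =
      (ε : ℂ) • lower (symbol ε w) := by
  have hε : (C (ε : ℂ) : Poly) = C ((ε : ℂ) / 2) + C ((ε : ℂ) / 2) := by rw [← C_add, add_halves]
  rw [map_sub, mul_assoc, mul_assoc, symbol_gen_mul, symbol_gen_mul, symbol_mul_gen,
    symbol_mul_gen, smul_eq_C_mul, hε]
  simp [leftOp_apply, rightOp_apply, Gen.sign, Gen.flip, lower_apply, pderiv_bp_ap]
  ring

theorem symbol_d {R ε : ℝ} (hε : ε ≠ 0) {w : W ε} (hw : w ∈ PsiR ε 0) :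
    symbol ε (d R ε w) = ((2 * Rhat R ε + ε : ℂ)⁻¹) •
      lower ((2 * Rhat R ε : ℂ) • symbol ε w + ((ε : ℂ) / 2) • euler (symbol ε w)) := by
  obtain ⟨h₁, h₂⟩ := (mem_PsiR_zero_iff hε).mp hw
  have hε' : (ε : ℂ) ≠ 0 := Complex.ofReal_ne_zero.mpr hε
  rw [d, map_smul, omega_eq R hε, symbol_rho, symbol_exchange, symbol_sandwich, h₁]
  generalize symbol ε w = p at h₁ h₂ ⊢
  have h₃ : lap (lower p) = 0 := by rw [lap_lower, h₁, map_zero]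
  have h₄ : lap (lower (euler p)) = 0 := by
    rw [lap_lower, lap_euler, h₁, map_zero, add_zero, add_zero, map_zero]
  -- `lower p` has weight `-2`, so reducing `quad * lower p` produces `-ε • lower p`, which cancels
  -- the `+ε • lower p` coming from the sandwich.
  simp only [map_add, map_smul, map_zero, smul_zero, add_zero, lower_quad_mul, rhoSymbol_quad_mul,
    weight_lower, h₂, h₃, rhoSymbol_of_lap_eq_zero R ε h₃, rhoSymbol_of_lap_eq_zero R ε h₄,
    zero_sub, map_sub, map_neg]
  push_cast
  match_scalars <;> field_simp
  ring

theorem d_mem_PsiR {R ε : ℝ} (hε : ε ≠ 0) {w : W ε} (hw : w ∈ PsiR ε 0) :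
    d R ε w ∈ PsiR ε (-1) := by
  obtain ⟨h₁, h₂⟩ := (mem_PsiR_zero_iff hε).mp hw
  rw [mem_PsiR_iff, symbol_d hε hw]
  generalize symbol ε w = p at h₁ h₂ ⊢
  simp only [map_add, map_smul, lap_lower, lap_euler, weight_lower, weight_euler, h₁, h₂, map_zero,
    add_zero, smul_zero, zero_sub, true_and]
  push_cast
  module

theorem apply_rotate_pow {S : Module.End ℂ Poly} (h : ∀ p, S (rotate p) = rotate (S p)) (k : ℕ)
    (p : Poly) : S ((rotate ^ k) p) = (rotate ^ k) (S p) := by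
  induction k generalizing p with
  | zero => rfl
  | succ k ih => rw [pow_succ, Module.End.mul_apply, Module.End.mul_apply, ih, h]

theorem symbol_P (ε : ℝ) (n r m : ℚ) :
    symbol ε (P ε n r m) = (((ε ^ ⌊n - m⌋₊)⁻¹ *
      √((⌊n + m⌋₊.factorial : ℝ) / ((⌊2 * n⌋₊.factorial : ℝ) * (⌊n - m⌋₊.factorial : ℝ))) :
        ℝ) : ℂ) • (ε : ℂ) ^ ⌊n - m⌋₊ •
      (rotate ^ ⌊n - m⌋₊) (X .ap ^ ⌊n + r⌋₊ * X .bm ^ ⌊n - r⌋₊) := by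
  rw [P, map_smul, symbol_ad_Jm_pow, symbol_ap_pow_mul_bm_pow]

theorem lap_ap_pow_mul_bm_pow (a b : ℕ) : lap (X .ap ^ a * X .bm ^ b : Poly) = 0 := by
  simp [lap_apply, Derivation.leibniz_pow]

theorem weight_ap_pow_mul_bm_pow (n : ℕ) : weight (X .ap ^ n * X .bm ^ n : Poly) = 0 := by
  rcases n with - | n
  · simp [weight_apply]
  · simp [weight_apply, Derivation.leibniz_pow]
    ring

theorem euler_ap_pow_mul_bm_pow (n : ℕ) :
    euler (X .ap ^ n * X .bm ^ n : Poly) = (2 * n : ℂ) • (X .ap ^ n * X .bm ^ n : Poly) := by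
  rw [smul_eq_C_mul]
  rcases n with - | n
  · simp [euler_apply]
  · simp [euler_apply, Derivation.leibniz_pow, map_ofNat]
    ring

theorem lower_ap_pow_mul_bm_pow (n : ℕ) :
    lower (X .ap ^ n * X .bm ^ n : Poly) =
      (n : ℂ) • (X .ap ^ (n - 1) * X .bm ^ (n + 1) : Poly) := by
  rw [smul_eq_C_mul]
  simp [lower_apply, Derivation.leibniz_pow]
  ring

theorem d_P {R ε : ℝ} (hε : ε ≠ 0) (n : ℕ) (m : ℚ) :
    d R ε (P ε n 0 m) =
      ((2 * n * (Rhat R ε + ε * n / 2) * (2 * Rhat R ε + ε)⁻¹ : ℝ) : ℂ) • P ε n (-1) m := by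
  -- For `n = 0` both sides truncate to `0`; this is harmless because the coefficient `2 * n * ⋯`
  -- vanishes.
  have ha : ⌊(n : ℚ) + -1⌋₊ = n - 1 := by rw [← sub_eq_add_neg]; exact Nat.floor_sub_one _
  have hb : ⌊(n : ℚ) - -1⌋₊ = n + 1 := by
    rw [sub_neg_eq_add, ← Nat.cast_add_one, Nat.floor_natCast]
  have h0 := symbol_P ε n 0 m
  rw [add_zero, sub_zero, Nat.floor_natCast] at h0
  have h1 := symbol_P ε n (-1) m
  rw [ha, hb] at h1
  have hP : P ε n 0 m ∈ PsiR ε 0 := by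
    rw [mem_PsiR_zero_iff hε, h0]
    simp only [map_smul, apply_rotate_pow lap_rotate, apply_rotate_pow weight_rotate,
      lap_ap_pow_mul_bm_pow, weight_ap_pow_mul_bm_pow, map_zero, smul_zero, and_self]
  refine symbol_injective ε ?_
  rw [symbol_d hε hP, map_smul, h0, h1]
  simp only [map_add, map_smul, apply_rotate_pow euler_rotate, apply_rotate_pow lower_rotate,
    euler_ap_pow_mul_bm_pow, lower_ap_pow_mul_bm_pow]
  push_cast
  module

theorem d_x {R ε : ℝ} (hε : ε ≠ 0) (hR : 0 < 2 * Rhat R ε + ε) (m : ℤ) :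
    d R ε (x R ε m) = dx R ε m := by
  have hs : ∀ (c : ℂ) (w : W ε), d R ε (c • w) = c • d R ε w := fun c w => by
    simp only [d, omega, mul_smul_comm, smul_mul_assoc, map_smul, Finset.smul_sum]
    exact Finset.sum_congr rfl fun _ _ => smul_comm _ _ _
  have h := d_P (R := R) hε 1 m
  have hc : 2 * ((1 : ℕ) : ℝ) * (Rhat R ε + ε * ((1 : ℕ) : ℝ) / 2) * (2 * Rhat R ε + ε)⁻¹ = 1 := by
    rw [Nat.cast_one]
    field_simp [hR.ne']
  rw [hc, Complex.ofReal_one, one_smul, Nat.cast_one] at h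
  rw [x, dx, hs, h]

/-! ### The classical limit -/

/-- The families of polynomials with a fixed finite set of monomials and coefficients `O(ε ^ k)`
as `ε → 0`. -/
def family (k : ℕ) : Submodule ℂ (ℝ → Poly) :=
  Submodule.span ℂ {F | ∃ (c : ℝ → ℂ) (p : Poly),
    c =O[𝓝 0] (fun ε : ℝ => ε ^ k) ∧ F = fun ε => c ε • p}

theorem smul_mem_family {k : ℕ} {c : ℝ → ℂ} (hc : c =O[𝓝 0] (fun ε : ℝ => ε ^ k)) (p : Poly) :
    (fun ε => c ε • p) ∈ family k :=
  Submodule.subset_span ⟨c, p, hc, rfl⟩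

theorem family_induction {k : ℕ} {motive : (ℝ → Poly) → Prop}
    (smul : ∀ (c : ℝ → ℂ) (p : Poly), c =O[𝓝 0] (fun ε : ℝ => ε ^ k) → motive fun ε => c ε • p)
    (add : ∀ F G, motive F → motive G → motive (F + G)) {F : ℝ → Poly} (hF : F ∈ family k) :
    motive F := by
  have h0 : motive 0 := by
    have := smul 0 0 (isBigO_zero _ _)
    simpa [Pi.zero_def] using this
  -- Strengthened to all multiples, so that the scalar step of the span induction is absorbed into
  -- the coefficient function.
  have : ∀ (a : ℂ), motive (a • F) := by
    induction hF using Submodule.span_induction with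
    | mem F h =>
      obtain ⟨c, p, hc, rfl⟩ := h
      intro a
      have := smul (fun ε => a * c ε) p (hc.const_mul_left a)
      simp only [mul_smul] at this
      exact this
    | zero => intro a; rwa [smul_zero]
    | add F G _ _ hF hG => intro a; rw [smul_add]; exact add _ _ (hF a) (hG a)
    | smul b F _ hF => intro a; rw [smul_smul]; exact hF _
  simpa using this 1

attribute [irreducible] family

theorem const_mem_family (p : Poly) : (fun _ => p) ∈ family 0 := by
  have := smul_mem_family (k := 0) (c := fun _ => 1) (by
    simpa using isBigO_const_const (1 : ℂ) (one_ne_zero (α := ℝ)) (𝓝 0)) p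
  simpa using this

theorem mul_mem_family {j k : ℕ} {c : ℝ → ℂ} (hc : c =O[𝓝 0] (fun ε : ℝ => ε ^ j)) {F : ℝ → Poly}
    (hF : F ∈ family k) : (fun ε => c ε • F ε) ∈ family (j + k) := by
  refine family_induction (motive := fun F => (fun ε => c ε • F ε) ∈ family (j + k)) ?_ ?_ hF
  · intro b p hb
    simp only [smul_smul]
    refine smul_mem_family ?_ p
    simpa only [pow_add] using hc.mul hb
  · intro F G hF hG
    simp only [Pi.add_apply, smul_add]
    exact (family _).add_mem hF hG

theorem family_succ_le (k : ℕ) : family (k + 1) ≤ family k := by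
  refine fun F hF => family_induction (fun c p hc => smul_mem_family (hc.trans ?_) p)
    (fun F G hF hG => (family k).add_mem hF hG) hF
  have : (fun ε : ℝ => ε) =O[𝓝 0] (fun _ : ℝ => (1 : ℝ)) :=
    continuousAt_id.tendsto.isBigO_one ℝ
  simpa only [pow_succ, mul_one] using (isBigO_refl (fun ε : ℝ => ε ^ k) _).mul this

theorem map_mem_family {k : ℕ} {F : ℝ → Poly} {T : ℝ → Module.End ℂ Poly} {j : ℕ}
    (hT : ∀ p, (fun ε => T ε p) ∈ family j) (hF : F ∈ family k) :
    (fun ε => T ε (F ε)) ∈ family (k + j) := by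
  refine family_induction (motive := fun F => (fun ε => T ε (F ε)) ∈ family (k + j)) ?_ ?_ hF
  · intro c p hc
    simp only [map_smul]
    exact mul_mem_family hc (hT p)
  · intro F G hF hG
    simp only [Pi.add_apply, map_add]
    exact (family _).add_mem hF hG

theorem map_const_mem_family {k : ℕ} {F : ℝ → Poly} (T : Module.End ℂ Poly) (hF : F ∈ family k) :
    (fun ε => T (F ε)) ∈ family k :=
  map_mem_family (T := fun _ => T) (fun p => const_mem_family (T p)) hF

theorem half_isBigO : (fun ε : ℝ => (ε : ℂ) / 2) =O[𝓝 0] (fun ε : ℝ => ε ^ 1) := by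
  refine IsBigO.of_bound 1 (Eventually.of_forall fun ε => ?_)
  simp only [pow_one, norm_div, Complex.norm_real, Complex.norm_ofNat, one_mul]
  exact half_le_self (norm_nonneg _)

theorem continuous_two_Rhat (R : ℝ) : Continuous fun ε : ℝ => (2 * Rhat R ε : ℂ) := by
  unfold Rhat
  fun_prop

theorem two_Rhat_isBigO (R : ℝ) :
    (fun ε : ℝ => (2 * Rhat R ε : ℂ)) =O[𝓝 0] (fun ε : ℝ => ε ^ 0) := by
  simpa using (continuous_two_Rhat R).continuousAt.tendsto.isBigO_one ℝ

/-- The coefficient of the correction to the classical exterior derivative. -/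
def correction (R ε : ℝ) : ℂ := (ε : ℂ) / 2 * (2 * Rhat R ε + ε : ℂ)⁻¹

theorem correction_isBigO {R : ℝ} (hR : 0 < R) :
    correction R =O[𝓝 0] (fun ε : ℝ => ε ^ 1) := by
  have h : ContinuousAt (fun ε : ℝ => ((2 * Rhat R ε : ℂ) + (ε : ℂ))⁻¹) 0 := by
    refine ContinuousAt.inv₀ ((continuous_two_Rhat R).add (by fun_prop)).continuousAt ?_
    simp [Rhat, Real.sqrt_sq hR.le, hR.ne']
  have := half_isBigO.mul (h.tendsto.isBigO_one ℝ)
  simp only [mul_one] at this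
  exact this

theorem rhoSymbol_mem_family (R : ℝ) (p : Poly) : (fun ε => rhoSymbol R ε p) ∈ family 0 := by
  obtain ⟨k, hk⟩ := exists_lap_pow_eq_zero p
  induction k generalizing p with
  | zero =>
    obtain rfl : p = 0 := by simpa using hk
    simpa using const_mem_family 0
  | succ k ih =>
    obtain ⟨h, r, hh, hr, rfl⟩ := exists_harmonic_add_quad_mul hk
    simp only [map_add, rhoSymbol_of_lap_eq_zero _ _ hh, rhoSymbol_quad_mul, sq, mul_smul (_ / (2 : ℂ))]
    have h1 := ih (weight r) (by rw [lap_pow_weight, hr, map_zero])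
    have h2 := ih (lap r) (lap_pow_lap hr)
    refine (family 0).add_mem (const_mem_family h) ((family 0).add_mem ((family 0).add_mem
      (family_succ_le 0 (mul_mem_family half_isBigO h1))
      (family_succ_le 0 (family_succ_le 1 (mul_mem_family half_isBigO
        (mul_mem_family half_isBigO h2))))) (mul_mem_family (two_Rhat_isBigO R) (ih r hr)))

/-- On harmonic polynomials the two operators commute exactly. Since `lower` commutes with
multiplication by `quad`, the reduction rule leaves terms carrying `ε / 2` or its square, plus the
bounded factor `2R̂` times the same defect for the quotient. -/
theorem lower_rhoSymbol_sub_mem_family (R : ℝ) (p : Poly) :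
    (fun ε => lower (rhoSymbol R ε p) - rhoSymbol R ε (lower p)) ∈ family 1 := by
  obtain ⟨k, hk⟩ := exists_lap_pow_eq_zero p
  induction k generalizing p with
  | zero =>
    obtain rfl : p = 0 := by simpa using hk
    simp only [map_zero, sub_zero]
    exact (family 1).zero_mem
  | succ k ih =>
    obtain ⟨h, r, hh, hr, rfl⟩ := exists_harmonic_add_quad_mul hk
    have hl : lap (lower h) = 0 := by rw [lap_lower, hh, map_zero]
    have e : ∀ p, (fun ε => rhoSymbol R ε p) ∈ family 0 := rhoSymbol_mem_family R
    have h1 := mul_mem_family half_isBigO ((family 0).sub_mem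
      (map_const_mem_family lower (e (weight r))) (e (weight (lower r))))
    have h2 := mul_mem_family half_isBigO (mul_mem_family half_isBigO ((family 0).sub_mem
      (map_const_mem_family lower (e (lap r))) (e (lap (lower r)))))
    have h3 := mul_mem_family (two_Rhat_isBigO R) (ih r hr)
    have := (family 1).add_mem ((family 1).add_mem h1 (family_succ_le 1 h2)) h3
    convert this using 1
    ext1 ε
    simp only [map_add, rhoSymbol_of_lap_eq_zero _ _ hh, rhoSymbol_of_lap_eq_zero _ _ hl,
      rhoSymbol_quad_mul, lower_quad_mul, map_smul, Pi.add_apply, Pi.sub_apply]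
    module

/-- The symbol of a product as a function of the symbols. -/
def star (ε : ℝ) : Poly →ₗ[ℂ] Module.End ℂ Poly := (leftRep ε).toLinearMap ∘ₗ weyl ε

theorem symbol_mul_eq_star (ε : ℝ) (v w : W ε) :
    symbol ε (v * w) = star ε (symbol ε v) (symbol ε w) := by
  rw [star, LinearMap.comp_apply, weyl_symbol]
  exact symbol_mul ε v w

/-! ### The product of symbols as a deformation of the commutative product -/

theorem leftOp_sub_mem_family {k : ℕ} {F : ℝ → Poly} (g : Gen) (hF : F ∈ family k) :
    (fun ε : ℝ => leftOp ((ε : ℂ) / 2) g (F ε) - X g * F ε) ∈ family (k + 1) := by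
  have h := mul_mem_family half_isBigO (map_const_mem_family
    (g.sign • (pderiv g.flip).toLinearMap) hF)
  rw [add_comm] at h
  convert h using 2 with ε
  rw [leftOp_apply, add_sub_cancel_left, C_mul, mul_assoc, ← smul_eq_C_mul, ← smul_eq_C_mul]
  rfl

theorem leftRep_toW_sub_mem_family (t : List Gen →₀ ℂ) (p : Poly) :
    (fun ε => leftRep ε (toW ε t) p - comm t * p) ∈ family 1 := by
  induction t using Finsupp.induction_linear with
  | zero =>
    simp only [map_zero, LinearMap.zero_apply, zero_mul, sub_zero]
    exact (family 1).zero_mem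
  | add s t hs ht =>
    convert (family 1).add_mem hs ht using 1
    ext1 ε
    simp only [map_add, LinearMap.add_apply, Pi.add_apply]
    ring
  | single l c =>
    have key : (fun ε => leftRep ε (l.map (gen ε)).prod p - (l.map X).prod * p) ∈ family 1 := by
      induction l with
      | nil =>
        simp only [List.map_nil, List.prod_nil, map_one, one_mul, Module.End.one_apply, sub_self]
        exact (family 1).zero_mem
      | cons g l ih =>
        have h0 : (fun ε => leftRep ε (l.map (gen ε)).prod p) ∈ family 0 := by
          have := (family 0).add_mem (family_succ_le 0 ih) (const_mem_family ((l.map X).prod * p))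
          simpa [Pi.add_def] using this
        have h1 := leftOp_sub_mem_family g h0
        have h2 := map_const_mem_family (LinearMap.mulLeft ℂ (X g)) ih
        convert (family 1).add_mem h1 h2 using 1
        ext1 ε
        simp only [List.map_cons, List.prod_cons, map_mul, Module.End.mul_apply, leftRep_gen,
          Pi.add_apply, LinearMap.mulLeft_apply]
        ring
    convert (family 1).smul_mem c key using 1
    ext1 ε
    simp only [toW, comm, ev, Finsupp.linearCombination_single, map_smul, LinearMap.smul_apply,
      Pi.smul_apply, smul_sub, smul_mul_assoc]

theorem star_sub_mul_mem_family (p r : Poly) :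
    (fun ε => star ε p r - p * r) ∈ family 1 := by
  have := leftRep_toW_sub_mem_family (symm p) r
  rw [comm_symm] at this
  exact this

theorem star_mem_family (p r : Poly) : (fun ε => star ε p r) ∈ family 0 := by
  have := (family 0).add_mem (family_succ_le 0 (star_sub_mul_mem_family p r))
    (const_mem_family (p * r))
  simpa [Pi.add_def] using this

/-- The exterior derivative on symbols. -/
def dSymbol (R ε : ℝ) : Module.End ℂ Poly :=
  lower + correction R ε • (lower ∘ₗ (euler - (2 : ℂ) • LinearMap.id))

theorem dSymbol_apply (R ε : ℝ) (p : Poly) :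
    dSymbol R ε p = lower p + correction R ε • lower (euler p - (2 : ℂ) • p) := rfl

/-- Rewrite `2R̂ + (ε/2) euler` as `(2R̂ + ε) + (ε/2)(euler - 2)`: the first term divides out to
`lower`, the second is the correction. -/
theorem symbol_d_eq_dSymbol {R ε : ℝ} (hε : ε ≠ 0) (hR : 2 * Rhat R ε + ε ≠ 0) {w : W ε}
    (hw : w ∈ PsiR ε 0) : symbol ε (d R ε w) = dSymbol R ε (symbol ε w) := by
  have h : (2 * Rhat R ε + ε : ℂ) ≠ 0 := by exact_mod_cast hR
  rw [symbol_d hε hw, dSymbol_apply, correction]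
  simp only [map_add, map_sub, map_smul]
  match_scalars <;> field_simp
  ring

theorem lap_dSymbol (R ε : ℝ) {p : Poly} (hp : lap p = 0) : lap (dSymbol R ε p) = 0 := by
  simp only [dSymbol_apply, map_add, map_sub, map_smul, lap_lower, lap_euler, hp, map_zero,
    smul_zero, add_zero, sub_zero]

/-- The symbol of the defect of the Leibniz rule. -/
def leibnizDefect (R : ℝ) (p r : Poly) (ε : ℝ) : Poly :=
  dSymbol R ε (rhoSymbol R ε (star ε p r)) - rhoSymbol R ε (star ε (dSymbol R ε p) r) -
    rhoSymbol R ε (star ε p (dSymbol R ε r))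

theorem lap_leibnizDefect (R : ℝ) (p r : Poly) (ε : ℝ) : lap (leibnizDefect R p r ε) = 0 := by
  rw [leibnizDefect, map_sub, map_sub, lap_dSymbol _ _ (lap_rhoSymbol _ _ _), lap_rhoSymbol,
    lap_rhoSymbol, sub_zero, sub_zero]

theorem leibnizDefect_mem_family {R : ℝ} (hR : 0 < R) (p r : Poly) :
    leibnizDefect R p r ∈ family 1 := by
  have hρ : ∀ {k : ℕ} {F : ℝ → Poly}, F ∈ family k → (fun ε => rhoSymbol R ε (F ε)) ∈ family k :=
    fun hF => map_mem_family (rhoSymbol_mem_family R) hF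
  let T : Module.End ℂ Poly := lower ∘ₗ (euler - (2 : ℂ) • LinearMap.id)
  -- `h1`, `h4`, `h6` collect the corrections to `d`; `h2`, `h5`, `h7` the noncommutativity of the
  -- product; `h3` the commutator of `lower` with the projection. What remains is the image under
  -- `rhoSymbol` of the Leibniz rule for `lower`.
  have h1 := mul_mem_family (correction_isBigO hR)
    (map_const_mem_family T (hρ (star_mem_family p r)))
  have h2 := map_const_mem_family lower (hρ (star_sub_mul_mem_family p r))
  have h3 := lower_rhoSymbol_sub_mem_family R (p * r)
  have h4 := mul_mem_family (correction_isBigO hR) (hρ (star_mem_family (T p) r))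
  have h5 := hρ (star_sub_mul_mem_family (lower p) r)
  have h6 := mul_mem_family (correction_isBigO hR) (hρ (star_mem_family p (T r)))
  have h7 := hρ (star_sub_mul_mem_family p (lower r))
  have := (family 1).sub_mem ((family 1).add_mem ((family 1).add_mem h1 h2) h3)
    ((family 1).add_mem ((family 1).add_mem h4 h5) ((family 1).add_mem h6 h7))
  convert this using 1
  ext1 ε
  have hT : ∀ p, dSymbol R ε p = lower p + correction R ε • T p := fun _ => rfl
  simp only [leibnizDefect, hT, map_add, map_sub, map_smul, LinearMap.add_apply,
    LinearMap.smul_apply, Pi.add_apply, Pi.sub_apply, lower_mul]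
  module

theorem exists_bound_of_mem_family {k : ℕ} {F : ℝ → Poly} (hF : F ∈ family k) :
    ∃ (C : ℝ) (S : Finset (List Gen)), ∀ᶠ ε in 𝓝 (0 : ℝ),
      (symm (F ε)).support ⊆ S ∧ ∀ l, ‖symm (F ε) l‖ ≤ C * |ε ^ k| := by
  classical
  refine family_induction (motive := fun F => ∃ (C : ℝ) (S : Finset (List Gen)),
    ∀ᶠ ε in 𝓝 (0 : ℝ), (symm (F ε)).support ⊆ S ∧ ∀ l, ‖symm (F ε) l‖ ≤ C * |ε ^ k|) ?_ ?_ hF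
  · intro c p hc
    obtain ⟨B, hB, hc⟩ := hc.exists_nonneg
    refine ⟨B * ∑ l ∈ (symm p).support, ‖symm p l‖, (symm p).support, ?_⟩
    filter_upwards [hc.bound] with ε h
    rw [map_smul]
    refine ⟨Finsupp.support_smul, fun l => ?_⟩
    have hl : ‖symm p l‖ ≤ ∑ l ∈ (symm p).support, ‖symm p l‖ := by
      by_cases hl : l ∈ (symm p).support
      · exact Finset.single_le_sum (f := fun l => ‖symm p l‖) (fun _ _ => norm_nonneg _) hl
      · rw [Finsupp.notMem_support_iff.mp hl, norm_zero]
        exact Finset.sum_nonneg fun _ _ => norm_nonneg _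
    rw [Finsupp.smul_apply, smul_eq_mul, norm_mul, mul_right_comm]
    exact mul_le_mul h hl (norm_nonneg _) (by positivity)
  · rintro F G ⟨C, S, h⟩ ⟨C', S', h'⟩
    refine ⟨C + C', S ∪ S', ?_⟩
    filter_upwards [h, h'] with ε h h'
    rw [Pi.add_apply, map_add]
    refine ⟨Finsupp.support_add.trans (Finset.union_subset_union h.1 h'.1), fun l => ?_⟩
    rw [Finsupp.add_apply, add_mul]
    exact (norm_add_le _ _).trans (add_le_add (h.2 l) (h'.2 l))

theorem two_Rhat_add_pos {R : ℝ} (hR : 0 < R) (ε : ℝ) : 0 < 2 * Rhat R ε + ε := by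
  have h : |ε| / 2 < Rhat R ε := by
    refine Real.lt_sqrt_of_sq_lt ?_
    rw [div_pow, sq_abs]
    nlinarith [sq_pos_of_pos hR]
  linarith [neg_abs_le ε]

theorem d_leibniz {R ε : ℝ} (hR : 0 < R) (hε : ε ≠ 0) {v w : W ε} (hv : v ∈ PsiR ε 0)
    (hw : w ∈ PsiR ε 0) :
    d R ε (rho R ε (v * w)) = rho R ε (d R ε v * w) + rho R ε (v * d R ε w) +
      weyl ε (leibnizDefect R (symbol ε v) (symbol ε w) ε) := by
  have hc : (ε : ℂ) / 2 ≠ 0 := div_ne_zero (Complex.ofReal_ne_zero.mpr hε) two_ne_zero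
  -- Weight zero means commuting with `K0`, a property visibly stable under products in the algebra.
  have hK : ∀ {u : W ε}, weight (symbol ε u) = 0 ↔ Ad ε (K0 ε) u = 0 := fun {u} => by
    rw [← (symbol_injective ε).eq_iff (b := 0), symbol_ad_K0, map_zero, smul_eq_zero_iff_right hc]
  have hvw : weight (symbol ε (v * w)) = 0 := by
    have h1 := hK.mp ((mem_PsiR_zero_iff hε).mp hv).2
    have h2 := hK.mp ((mem_PsiR_zero_iff hε).mp hw).2
    rw [hK]
    simp only [Ad, LinearMap.sub_apply, LinearMap.mulLeft_apply, LinearMap.mulRight_apply,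
      sub_eq_zero] at h1 h2 ⊢
    rw [← mul_assoc, h1, mul_assoc, h2, mul_assoc]
  have hρ : rho R ε (v * w) ∈ PsiR ε 0 := by
    rw [mem_PsiR_zero_iff hε, symbol_rho]
    exact ⟨lap_rhoSymbol _ _ _, weight_rhoSymbol _ _ hvw⟩
  have hne := (two_Rhat_add_pos hR ε).ne'
  refine symbol_injective ε ?_
  rw [symbol_d_eq_dSymbol hε hne hρ]
  simp only [map_add, symbol_rho, symbol_mul_eq_star, symbol_d_eq_dSymbol hε hne hv,
    symbol_d_eq_dSymbol hε hne hw, symbol_weyl, leibnizDefect]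
  abel

end FuzzySphere

end

theorem mainTheorem9 :
    (∀ R ε : ℝ, 0 ≤ R → ε ≠ 0 → 0 < 2 * FuzzySphere.Rhat R ε + ε →
      (∀ f ∈ FuzzySphere.PsiR ε 0, FuzzySphere.d R ε f ∈ FuzzySphere.PsiR ε (-1)) ∧
      (∀ m : ℤ, |m| ≤ 1 →
        FuzzySphere.d R ε (FuzzySphere.x R ε m) = FuzzySphere.dx R ε m) ∧
      (∀ (n : ℕ) (m : ℤ), |m| ≤ (n : ℤ) →
        FuzzySphere.d R ε (FuzzySphere.P ε n 0 m) =
          ((2 * n * (FuzzySphere.Rhat R ε + ε * n / 2) * (2 * FuzzySphere.Rhat R ε + ε)⁻¹ : ℝ) :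
            ℂ) • FuzzySphere.P ε n (-1) m)) ∧
    (∀ R : ℝ, 0 < R → ∀ f ∈ FuzzySphere.SymTraceless, ∀ g ∈ FuzzySphere.SymTraceless,
      (∀ ε : ℝ, FuzzySphere.toW ε f ∈ FuzzySphere.PsiR ε 0) →
      (∀ ε : ℝ, FuzzySphere.toW ε g ∈ FuzzySphere.PsiR ε 0) →
      ∃ (C δ : ℝ) (S : Finset (List FuzzySphere.Gen)), 0 < δ ∧
        ∀ ε : ℝ, 0 < |ε| → |ε| < δ →
          ∃ e ∈ FuzzySphere.SymTraceless, e.support ⊆ S ∧ (∀ l, ‖e l‖ ≤ C * |ε|) ∧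
            FuzzySphere.d R ε
                (FuzzySphere.rho R ε (FuzzySphere.toW ε f * FuzzySphere.toW ε g)) =
              FuzzySphere.rho R ε
                  (FuzzySphere.d R ε (FuzzySphere.toW ε f) * FuzzySphere.toW ε g) +
                FuzzySphere.rho R ε
                  (FuzzySphere.toW ε f * FuzzySphere.d R ε (FuzzySphere.toW ε g)) +
                FuzzySphere.toW ε e) := by
  refine ⟨fun R ε _ hε hR => ⟨fun f hf => FuzzySphere.d_mem_PsiR hε hf,
    fun m _ => FuzzySphere.d_x hε hR m, fun n m _ => FuzzySphere.d_P hε n m⟩, ?_⟩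
  intro R hR f hf g hg hf' hg'
  obtain ⟨C, S, h⟩ := FuzzySphere.exists_bound_of_mem_family
    (FuzzySphere.leibnizDefect_mem_family hR (FuzzySphere.comm f) (FuzzySphere.comm g))
  obtain ⟨δ, hδ, h⟩ := Metric.eventually_nhds_iff.mp h
  refine ⟨C, δ, S, hδ, fun ε hε hε' => ?_⟩
  obtain ⟨hS, hC⟩ := h (by rwa [Real.dist_eq, sub_zero])
  -- The error is `symm` of `leibnizDefect`; `symm` does not involve `ε`, so bounds on the family
  -- pass to coefficients of words.
  refine ⟨_, ?_, hS, fun l => by simpa only [pow_one] using hC l, ?_⟩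
  · rw [FuzzySphere.mem_symTraceless_iff (FuzzySphere.symm_mem_sym _), FuzzySphere.comm_symm]
    exact FuzzySphere.lap_leibnizDefect _ _ _ _
  · rw [FuzzySphere.d_leibniz hR (abs_pos.mp hε) (hf' ε) (hg' ε), FuzzySphere.symbol_toW hf.1,
      FuzzySphere.symbol_toW hg.1]
    rfl
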